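/- All graphs are finite, simple and undirected. A graph $G$ is $H$-free if it contains no (not necessarily induced) subgraph isomorphic to $H$, and $G$ is $\epsilon$-far from $H$-freeness if at least $\epsilon|V(G)|$ edges must be added to or removed from $G$ to obtain an $H$-free graph. For a linear order $\le$ on $V(G)$, a path of length at most $r$ from $v$ to $x$ is $r$-admissible if $x<v$ and all its inner vertices are larger than $v$. An $r$-admissible path packing rooted at $v$ is a collection of $r$-admissible paths starting in $v$ that are pairwise vertex-disjoint except for $v$. The graph $G$ is $(p,r)$-admissible if for some linear order on $V(G)$ every $r$-admissible path packing at every vertex consists of at most $p$ paths. Let $p\ge 2$ and $r$ be natural numbers, let $H$ be a connected graph with $|V(H)|\le r$, and let $\epsilon>0$. Put $$\epsilon'=\tfrac{\epsilon}{2},\quad \alpha=\frac{8p^2}{\epsilon'},\quad \beta=\frac{8p^{16r^2\log_2 r}}{\epsilon'},\quad \delta=2^{12}\beta^3 r,\quad \xi_1=\Big\lceil\frac{20\alpha}{\epsilon'}\Big\rceil,\quad \xi_2=r^2+3r+1,\quad \xi_3=\lceil 20r\delta\rceil .$$ Consider the following algorithm. It is given $n\ge 1$ and access to a graph $G$ on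 $n$ vertices through a random neighbour oracle, which on a query $v\in V(G)$ returns an independent and uniformly random neighbour of $v$ (or reports that $v$ is isolated). It starts with the explored graph consisting of $\xi_1$ independent uniformly random vertices of $G$ and no edges. Then it repeats the following $\xi_2$ times: for each vertex $v$ of the explored graph at the beginning of the round, it makes $\xi_3$ queries for a random neighbour $u$ of $v$ and adds each returned vertex $u$ and edge $vu$ to the explored graph. Finally it rejects if the explored graph contains $H$ as a subgraph, and accepts otherwise. Then: 1. If the input graph $G$ is $H$-free, the algorithm accepts with probability $1$. 2. If the input graph $G$ is $(p,r)$-admissible and $\epsilon$-far from $H$-freeness, the algorithm rejects with probability at least $2/3$. 3. The query complexity of the algorithm (the maximum number of oracle queries it makes) is independent of the size of the input graph: it is bounded by a number that depends only on $p$, $r$ and $\epsilon$. -/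

import Mathlib

namespace HFreeness

/-! ### Admissibility -/

section Ordered

variable {V : Type*} [LinearOrder V] (G : SimpleGraph V)

/-- A path of `G` from `v` to `x` is `r`-admissible for the given vertex order if its end `x`
precedes its root `v`, all its inner vertices come after `v`, and it has at most `r` edges. -/
def IsAdmissiblePath (r : ℕ) {v x : V} (P : G.Walk v x) : Prop :=
  P.IsPath ∧ x < v ∧ (∀ w ∈ P.support, w ≠ v → w ≠ x → v < w) ∧ P.length ≤ r

/-- An admissible path packing with root `v`: a collection of `r`-admissible paths starting in `v`
which are pairwise vertex-disjoint apart from `v`. -/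
def IsPathPacking (r : ℕ) (v : V) (S : Set (Σ x : V, G.Walk v x)) : Prop :=
  (∀ P ∈ S, IsAdmissiblePath G r P.2) ∧
    ∀ P ∈ S, ∀ Q ∈ S, P ≠ Q → P.2.support.tail.Disjoint Q.2.support.tail

/-- The maximum size of an `r`-admissible path packing with root `v`. -/
noncomputable def packingNumber (r : ℕ) (v : V) : ℕ∞ :=
  ⨆ (S : Set (Σ x : V, G.Walk v x)) (_ : IsPathPacking G r v S), S.encard

/-- The `r`-admissibility of an ordered graph. -/
noncomputable def orderedAdm (r : ℕ) : ℕ∞ :=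
  ⨆ v : V, packingNumber G r v

end Ordered

/-- The `r`-admissibility of a graph: the minimum over all linear orders of its vertices. -/
noncomputable def adm {V : Type*} (G : SimpleGraph V) (r : ℕ) : ℕ∞ :=
  ⨅ o : LinearOrder V, @orderedAdm V o G r

/-- `(p, r)`-admissible graphs. -/
def IsAdmissible {V : Type*} (p r : ℕ) (G : SimpleGraph V) : Prop :=
  adm G r ≤ p

/-! ### Distance to a property -/

/-- `G` is `ε`-far from the graph property `P`: at least `ε |V(G)|` edges must be added or removed
to obtain a graph with the property. -/
def IsFar {V : Type*} [Fintype V] (ε : ℝ) (P : SimpleGraph V → Prop) (G : SimpleGraph V) : Prop :=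
  ∀ G' : SimpleGraph V, P G' →
    ε * (Fintype.card V : ℝ) ≤ ((symmDiff G.edgeSet G'.edgeSet).ncard : ℝ)

/-! ### Randomised algorithms with random neighbour oracle access -/

/-- A randomised algorithm on the vertex set `V` with random neighbour oracle access, as a decision
tree. It stops with an output, draws a uniformly random vertex, or queries the oracle for a random
neighbour of a vertex `v` (the answer `none` reports that `v` is isolated). It is not given the
input graph, only the answers of the oracle. -/
inductive OracleAlg (V : Type) (α : Type) : Type
  | done (a : α) : OracleAlg V α
  | sample (next : V → OracleAlg V α) : OracleAlg V α
  | query (v : V) (next : Option V → OracleAlg V α) : OracleAlg V α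

namespace OracleAlg

variable {V α β : Type}

/-- Sequential composition. -/
def bind : OracleAlg V α → (α → OracleAlg V β) → OracleAlg V β
  | done a, f => f a
  | sample next, f => sample fun v => (next v).bind f
  | query v next, f => query v fun a => (next a).bind f

/-- Run `step` exactly `m` times, passing on the state. -/
def repeatTimes (step : α → OracleAlg V α) : ℕ → α → OracleAlg V α
  | 0, s => done s
  | m + 1, s => (step s).bind (repeatTimes step m)

/-- Run `step v` for the entries `v` of a list one after the other, passing on the state. -/
def forEach (step : V → α → OracleAlg V α) : List V → α → OracleAlg V α
  | [], s => done s
  | v :: l, s => (step v s).bind (forEach step l)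

open Classical in
/-- The answer of the random neighbour oracle: a uniformly random neighbour of `v`. -/
noncomputable def neighbourOracle [Fintype V] (G : SimpleGraph V) (v : V) : PMF (Option V) :=
  if h : (Finset.univ.filter fun u => G.Adj v u).Nonempty then
    (PMF.uniformOfFinset (Finset.univ.filter fun u => G.Adj v u) h).map some
  else PMF.pure none

/-- The distribution of the output on the input graph `G`; all random choices are independent. -/
noncomputable def run [Fintype V] [Nonempty V] (G : SimpleGraph V) : OracleAlg V α → PMF α
  | done a => PMF.pure a
  | sample next => (PMF.uniformOfFintype V).bind fun v => run G (next v)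
  | query v next => (neighbourOracle G v).bind fun a => run G (next a)

/-- The query complexity: the maximum number of oracle queries over all possible vertex draws and
oracle answers. -/
def queryComplexity [Fintype V] : OracleAlg V α → ℕ
  | done _ => 0
  | sample next => Finset.univ.sup fun v => queryComplexity (next v)
  | query _ next => 1 + Finset.univ.sup fun a => queryComplexity (next a)

end OracleAlg

/-! ### The tester -/

/-- The part of the input graph that has been explored. -/
structure Explored (V : Type) where
  verts : Finset V
  edges : Finset (Sym2 V)

namespace Explored

variable {V : Type}

/-- The explored part as a graph. -/
def graph (S : Explored V) : SimpleGraph (S.verts : Set V) :=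
  (SimpleGraph.fromEdgeSet (S.edges : Set (Sym2 V))).induce (S.verts : Set V)

variable [DecidableEq V]

/-- Add a vertex. -/
def addVertex (v : V) (S : Explored V) : Explored V :=
  ⟨insert v S.verts, S.edges⟩

/-- Record the answer to a query at `v`. -/
def addAnswer (v : V) (S : Explored V) : Option V → Explored V
  | none => S
  | some u => ⟨insert u S.verts, insert s(v, u) S.edges⟩

end Explored

inductive Verdict
  | accept
  | reject

section Tester

variable {V : Type} [DecidableEq V]

/-- Add `m` independent uniformly random vertices to the empty graph. -/
def initialSample (m : ℕ) : OracleAlg V (Explored V) :=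
  OracleAlg.repeatTimes (fun S => .sample fun v => .done (S.addVertex v)) m ⟨∅, ∅⟩

/-- Query `m` times for a random neighbour of `v`. -/
def innerLoop (m : ℕ) (v : V) : Explored V → OracleAlg V (Explored V) :=
  OracleAlg.repeatTimes (fun S => .query v fun a => .done (S.addAnswer v a)) m

/-- Run the inner loop for each vertex that was explored before this round. -/
noncomputable def middleLoop (m : ℕ) (S : Explored V) : OracleAlg V (Explored V) :=
  OracleAlg.forEach (innerLoop m) S.verts.toList S

/-- The exploration: `m₁` random vertices, then `m₂` rounds with `m₃` queries for each vertex. -/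
noncomputable def explore (m₁ m₂ m₃ : ℕ) : OracleAlg V (Explored V) :=
  (initialSample m₁).bind (OracleAlg.repeatTimes (middleLoop m₃) m₂)

open Classical in
/-- Reject if and only if the explored graph contains `H` as a (not necessarily induced)
subgraph. -/
noncomputable def decideContains {W : Type*} (H : SimpleGraph W) (S : Explored V) : Verdict :=
  if H.IsContained S.graph then .reject else .accept

end Tester

noncomputable def alpha (p : ℕ) (ε : ℝ) : ℝ := 8 * (p : ℝ) ^ 2 / (ε / 2)

noncomputable def beta (p r : ℕ) (ε : ℝ) : ℝ :=
  8 * (p : ℝ) ^ (16 * (r : ℝ) ^ 2 * Real.logb 2 r) / (ε / 2)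

noncomputable def delta (p r : ℕ) (ε : ℝ) : ℝ := 2 ^ 12 * beta p r ε ^ 3 * r

/-- The number of vertices sampled initially. -/
noncomputable def xi₁ (p : ℕ) (ε : ℝ) : ℕ := ⌈20 * alpha p ε / (ε / 2)⌉₊

/-- The number of rounds. -/
def xi₂ (r : ℕ) : ℕ := r ^ 2 + 3 * r + 1

/-- The number of queries per explored vertex and round. -/
noncomputable def xi₃ (p r : ℕ) (ε : ℝ) : ℕ := ⌈20 * r * delta p r ε⌉₊

/-- The tester for `H`-freeness, with `H`, `p`, `r` hard-coded, for the proximity parameter `ε` and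
input graphs on `n` vertices. -/
noncomputable def tester {W : Type*} (H : SimpleGraph W) (p r : ℕ) (ε : ℝ) (n : ℕ) :
    OracleAlg (Fin n) Verdict :=
  (explore (xi₁ p ε) (xi₂ r) (xi₃ p r ε)).bind fun S => .done (decideContains H S)

end HFreeness

namespace HFreeness

/-! ### Failure probabilities -/

/-! Explored edges are edges of the input with probability 1, so an `H`-free graph is accepted, and
a round multiplies the number of explored vertices by at most `1 + ξ₃`, which bounds the queries
independently of `n`. The real content is rejection.

Fix an order witnessing admissibility. `exists_reroutable` deletes at most `(ε/2) n` edges of `G`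
and leaves a graph `G'` in which every edge has an end of `G`-degree at most `α` and every copy of
`H` is `Reroutable`: whatever proper part of a copy has been found, some found vertex has a `1/δ`
fraction of its `G`-neighbours along which another copy continues the same part. So each round is
likely to find one more vertex of a copy, the target copy changing on the way; once all vertices are
found, the missing edges are found from their light ends (`failProb_progress_le`). Half of the
distance survives the deletions, so a constant fraction of the vertices lies on copies in `G'`
(`exists_many_on_copies`) and the initial sample is likely to hit one.

Reroutability comes from greedy pruning. Consider the copies with a prescribed image of `k` (the
root) and of some further vertices, and a neighbour `h` of `k`. Either, for every set of `p * r`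
vertices, many neighbours of the root occur as images of `h` in copies whose branch at `h` avoids
the set; or few edges at the root can be deleted so that the branch of each surviving copy meets a
small set `B`, away from the image of `h` (`Pruning.extend`). In the second case a vertex with image
in `B` is prescribed as well, which cuts the branch. The prescriptions form a tree of bounded depth
and branching, so the total cost is small.

In the first case the branch contains no vertex before the root: otherwise it would contain an
admissible path (`exists_admissible_path_of_low`), while `p * r` vertices hit all admissible paths
from the root (`exists_hitting_set`). If the root is the last boundary vertex of the found part,
such a branch is disjoint from the found part and can be exchanged. -/

/-- The probability that an event fails. -/
noncomputable def failProb {α : Type*} (μ : PMF α) (P : α → Prop) : ENNReal :=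
  μ.toOuterMeasure {a | ¬ P a}

section FailProb

open scoped ENNReal

variable {α β : Type*}

theorem failProb_le_one (μ : PMF α) (P : α → Prop) : failProb μ P ≤ 1 := by
  have h := μ.toOuterMeasure.mono (Set.subset_univ {a | ¬ P a})
  have h1 : μ.toOuterMeasure Set.univ = 1 := by
    rw [PMF.toOuterMeasure_apply_eq_one_iff]
    exact Set.subset_univ _
  exact h.trans h1.le

theorem failProb_mono {μ : PMF α} {P Q : α → Prop} (h : ∀ a, P a → Q a) :
    failProb μ Q ≤ failProb μ P :=
  μ.toOuterMeasure.mono fun _ ha hp => ha (h _ hp)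

theorem failProb_and_le (μ : PMF α) (P Q : α → Prop) :
    failProb μ (fun a => P a ∧ Q a) ≤ failProb μ P + failProb μ Q := by
  refine le_trans (μ.toOuterMeasure.mono ?_) (MeasureTheory.measure_union_le _ _)
  intro a ha
  by_cases h : P a
  · exact Or.inr fun hq => ha ⟨h, hq⟩
  · exact Or.inl h

theorem failProb_pure {a : α} {P : α → Prop} (h : P a) : failProb (PMF.pure a) P = 0 := by
  simp [failProb, PMF.toOuterMeasure_pure_apply, h]

theorem failProb_bind (μ : PMF α) (f : α → PMF β) (Q : β → Prop) :
    failProb (μ.bind f) Q = ∑' a, μ a * failProb (f a) Q := by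
  rw [failProb, PMF.toOuterMeasure_bind_apply]; rfl

theorem failProb_eq_tsum (μ : PMF α) (P : α → Prop) :
    failProb μ P = ∑' a, {a | ¬ P a}.indicator μ a :=
  μ.toOuterMeasure_apply _

/-- The union bound for two consecutive stages: the first misses `P`, or the second fails after `P`.
-/
theorem failProb_bind_le {μ : PMF α} {f : α → PMF β} {P : α → Prop} {Q : β → Prop} {e : ℝ≥0∞}
    (h : ∀ a, P a → failProb (f a) Q ≤ e) : failProb (μ.bind f) Q ≤ failProb μ P + e := by
  rw [failProb_bind, failProb_eq_tsum]
  calc ∑' a, μ a * failProb (f a) Q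
      ≤ ∑' a, ({a | ¬ P a}.indicator μ a + μ a * e) := by
        refine ENNReal.tsum_le_tsum fun a => ?_
        by_cases hp : P a
        · exact le_add_left (mul_le_mul_right (h a hp) _)
        · have : {a | ¬ P a}.indicator μ a = μ a := Set.indicator_of_mem hp _
          rw [this]
          refine le_add_right ?_
          calc μ a * failProb (f a) Q ≤ μ a * 1 := mul_le_mul_right (failProb_le_one _ _) _
            _ = μ a := mul_one _
    _ = _ := by rw [ENNReal.tsum_add, ENNReal.tsum_mul_right, μ.tsum_coe, one_mul]

theorem failProb_bind_le_mul {μ : PMF α} {f : α → PMF β} {P : α → Prop} {Q : β → Prop}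
    {e : ℝ≥0∞} (h : ∀ a, P a → failProb (f a) Q = 0) (h' : ∀ a, failProb (f a) Q ≤ e) :
    failProb (μ.bind f) Q ≤ failProb μ P * e := by
  rw [failProb_bind, failProb_eq_tsum, ← ENNReal.tsum_mul_right]
  refine ENNReal.tsum_le_tsum fun a => ?_
  by_cases hp : P a
  · simp [h a hp]
  · have : {a | ¬ P a}.indicator μ a = μ a := Set.indicator_of_mem hp _
    rw [this]
    exact mul_le_mul_right (h' a) _

theorem failProb_bind_le_sup {μ : PMF α} {f : α → PMF β} {Q : β → Prop}
    {e : ℝ≥0∞} (h : ∀ a, failProb (f a) Q ≤ e) : failProb (μ.bind f) Q ≤ e := by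
  have := failProb_bind_le (μ := μ) (f := f) (P := fun _ => True) (Q := Q) (fun a _ => h a)
  simpa [failProb] using this

theorem apply_add_failProb (μ : PMF α) (a : α) : μ a + failProb μ (· = a) = 1 := by
  classical
  rw [failProb_eq_tsum, ← μ.tsum_coe, ENNReal.tsum_eq_add_tsum_ite (f := μ) a]
  congr 1
  refine tsum_congr fun x => ?_
  by_cases hx : x = a <;> simp [hx, Set.indicator]

theorem failProb_uniformOfFinset_le {s A : Finset α} (hs : s.Nonempty) (hA : A ⊆ s) {c : ℝ}
    (hc : c * s.card ≤ A.card) :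
    failProb (PMF.uniformOfFinset s hs) (· ∈ A) ≤ ENNReal.ofReal (1 - c) := by
  classical
  have hpos : 0 < (s.card : ℝ) := by exact_mod_cast hs.card_pos
  rw [failProb, PMF.toOuterMeasure_uniformOfFinset_apply]
  have h2 : ((s \ A).card : ℝ) = s.card - A.card := by
    rw [Finset.card_sdiff_of_subset hA, Nat.cast_sub (Finset.card_le_card hA)]
  have h1 : (s.filter (· ∈ {a | ¬ a ∈ A})).card = (s \ A).card := by congr 1; ext; simp
  refine (le_of_eq (b := ((s \ A).card : ENNReal) / s.card) (by rw [← h1]; congr!)).trans ?_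
  rw [← ENNReal.ofReal_natCast, ← ENNReal.ofReal_natCast, ← ENNReal.ofReal_div_of_pos hpos]
  apply ENNReal.ofReal_le_ofReal
  rw [h2, div_le_iff₀ hpos]
  linarith

end FailProb

/-! ### Runs of oracle algorithms -/

namespace OracleAlg

open scoped ENNReal

variable {V α β : Type}

/-- All outputs of the algorithm, whatever the answers, satisfy `P`. -/
def AllOutputs (P : α → Prop) : OracleAlg V α → Prop
  | done a => P a
  | sample next => ∀ v, AllOutputs P (next v)
  | query _ next => ∀ a, AllOutputs P (next a)

theorem allOutputs_true : ∀ x : OracleAlg V α, x.AllOutputs fun _ => True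
  | done _ => trivial
  | sample next => fun v => allOutputs_true (next v)
  | query _ next => fun a => allOutputs_true (next a)

theorem AllOutputs.bind {P : α → Prop} {Q : β → Prop} {f : α → OracleAlg V β}
    (hf : ∀ a, P a → (f a).AllOutputs Q) :
    ∀ {x : OracleAlg V α}, x.AllOutputs P → (x.bind f).AllOutputs Q
  | done a, h => hf a h
  | sample next, h => fun v => AllOutputs.bind hf (x := next v) (h v)
  | query _ next, h => fun a => AllOutputs.bind hf (x := next a) (h a)

theorem AllOutputs.mono {P Q : α → Prop} (h : ∀ a, P a → Q a) :
    ∀ {x : OracleAlg V α}, x.AllOutputs P → x.AllOutputs Q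
  | done a, hx => h a hx
  | sample _, hx => fun v => AllOutputs.mono h (hx v)
  | query _ _, hx => fun a => AllOutputs.mono h (hx a)

theorem allOutputs_repeatTimes {step : α → OracleAlg V α} {I : ℕ → α → Prop}
    (h : ∀ i s, I i s → (step s).AllOutputs (I (i + 1))) :
    ∀ (m i : ℕ) (s : α), I i s → (repeatTimes step m s).AllOutputs (I (i + m))
  | 0, _, _, hs => hs
  | m + 1, i, s, hs => by
    refine AllOutputs.bind (P := I (i + 1)) (fun a ha => ?_) (h i s hs)
    have := allOutputs_repeatTimes h m (i + 1) a ha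
    rwa [show i + 1 + m = i + (m + 1) by omega] at this

theorem allOutputs_forEach {step : V → α → OracleAlg V α} {I : ℕ → α → Prop}
    (h : ∀ v i s, I i s → (step v s).AllOutputs (I (i + 1))) :
    ∀ (l : List V) (i : ℕ) (s : α), I i s → (forEach step l s).AllOutputs (I (i + l.length))
  | [], _, _, hs => hs
  | v :: l, i, s, hs => by
    refine AllOutputs.bind (P := I (i + 1)) (fun a ha => ?_) (h v i s hs)
    have := allOutputs_forEach h l (i + 1) a ha
    rwa [show i + 1 + l.length = i + (l.length + 1) by omega] at this

section QueryComplexity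

variable [Fintype V]

/-- The invariant `P` lets the cost of the continuation depend on what is guaranteed about the
intermediate state, such as the number of explored vertices. -/
theorem queryComplexity_bind_le {P : α → Prop} {f : α → OracleAlg V β} {c : ℕ}
    (hf : ∀ a, P a → (f a).queryComplexity ≤ c) :
    ∀ {x : OracleAlg V α}, x.AllOutputs P → (x.bind f).queryComplexity ≤ x.queryComplexity + c
  | done a, h => by simpa [bind, queryComplexity] using hf a h
  | sample next, h => by
    refine Finset.sup_le fun v _ => ?_
    refine (queryComplexity_bind_le hf (x := next v) (h v)).trans ?_
    exact Nat.add_le_add_right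
      (Finset.le_sup (f := fun v => queryComplexity (next v)) (Finset.mem_univ v)) c
  | query v next, h => by
    change 1 + _ ≤ 1 + _ + c
    rw [add_assoc]
    refine Nat.add_le_add_left (Finset.sup_le fun a _ => ?_) 1
    refine (queryComplexity_bind_le hf (x := next a) (h a)).trans ?_
    exact Nat.add_le_add_right
      (Finset.le_sup (f := fun v => queryComplexity (next v)) (Finset.mem_univ a)) c

theorem queryComplexity_repeatTimes_le {step : α → OracleAlg V α} {I : ℕ → α → Prop} {c : ℕ → ℕ}
    (h : ∀ i s, I i s → (step s).AllOutputs (I (i + 1)))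
    (hc : ∀ i s, I i s → (step s).queryComplexity ≤ c i) :
    ∀ (m i : ℕ) (s : α), I i s →
      (repeatTimes step m s).queryComplexity ≤ ∑ j ∈ Finset.range m, c (i + j)
  | 0, _, _, _ => le_rfl
  | m + 1, i, s, hs => by
    refine (queryComplexity_bind_le
      (fun a ha => queryComplexity_repeatTimes_le h hc m (i + 1) a ha) (h i s hs)).trans ?_
    rw [Finset.sum_range_succ', add_comm]
    refine Nat.add_le_add (le_of_eq (Finset.sum_congr rfl fun j _ => ?_)) (hc i s hs)
    congr 1; omega

theorem queryComplexity_forEach_le {step : V → α → OracleAlg V α} {c : ℕ}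
    (hc : ∀ v s, (step v s).queryComplexity ≤ c) :
    ∀ (l : List V) (s : α), (forEach step l s).queryComplexity ≤ l.length * c
  | [], _ => by simp [forEach, queryComplexity]
  | v :: l, s => by
    refine (queryComplexity_bind_le
      (fun a _ => queryComplexity_forEach_le hc l a) (allOutputs_true _)).trans ?_
    have := hc v s
    rw [List.length_cons, Nat.succ_mul]
    omega

end QueryComplexity

section Run

variable [Fintype V] [Nonempty V] (G : SimpleGraph V)

theorem run_bind (f : α → OracleAlg V β) :
    ∀ x : OracleAlg V α, run G (x.bind f) = (run G x).bind fun a => run G (f a)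
  | done a => by simp [bind, run]
  | sample next => by
    simp only [bind, run, PMF.bind_bind]
    congr 1; funext v; exact run_bind f (next v)
  | query v next => by
    simp only [bind, run, PMF.bind_bind]
    congr 1; funext v; exact run_bind f (next v)

theorem failProb_run_of_allOutputs {P : α → Prop} :
    ∀ {x : OracleAlg V α}, x.AllOutputs P → failProb (run G x) P = 0
  | done _, h => failProb_pure h
  | sample _, h => le_antisymm
      (failProb_bind_le_sup fun v => (failProb_run_of_allOutputs (h v)).le) bot_le
  | query _ _, h => le_antisymm
      (failProb_bind_le_sup fun a => (failProb_run_of_allOutputs (h a)).le) bot_le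

/-- An invariant that one step keeps up to probability `e`. -/
theorem failProb_repeatTimes_le {step : α → OracleAlg V α} {I : ℕ → α → Prop} {e : ℝ≥0∞}
    (h : ∀ i s, I i s → failProb (run G (step s)) (I (i + 1)) ≤ e) :
    ∀ (m i : ℕ) (s : α), I i s → failProb (run G (repeatTimes step m s)) (I (i + m)) ≤ m * e
  | 0, _, _, hs => by simp [repeatTimes, run, failProb_pure (P := I _) hs]
  | m + 1, i, s, hs => by
    rw [repeatTimes, run_bind]
    refine (failProb_bind_le (P := I (i + 1)) (e := m * e) fun a ha => ?_).trans ?_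
    · have := failProb_repeatTimes_le h m (i + 1) a ha
      rwa [show i + 1 + m = i + (m + 1) by omega] at this
    · refine (add_le_add_left (h i s hs) _).trans (le_of_eq ?_)
      push_cast; ring

/-- Independent attempts at an event that persists. -/
theorem failProb_repeatTimes_le_pow {step : α → OracleAlg V α} {P : α → Prop} {e : ℝ≥0∞}
    (hP : ∀ s, P s → (step s).AllOutputs P) (h : ∀ s, failProb (run G (step s)) P ≤ e) :
    ∀ (m : ℕ) (s : α), failProb (run G (repeatTimes step m s)) P ≤ e ^ m
  | 0, s => by simpa using failProb_le_one _ _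
  | m + 1, s => by
    rw [repeatTimes, run_bind, pow_succ, mul_comm]
    refine (failProb_bind_le_mul (P := P) (fun a ha => ?_)
      (failProb_repeatTimes_le_pow hP h m)).trans (mul_le_mul_left (h s) _)
    exact failProb_run_of_allOutputs G
      (allOutputs_repeatTimes (I := fun _ => P) (fun _ s hs => hP s hs) m 0 a ha)

/-- Only the step at the last occurrence of `v` in the list has to succeed; the steps after it
preserve `P` surely, and the state before it is arbitrary. -/
theorem failProb_forEach_le {step : V → α → OracleAlg V α} {P : α → Prop} {e : ℝ≥0∞} {v : V}
    (hP : ∀ w s, P s → (step w s).AllOutputs P) (h : ∀ s, failProb (run G (step v s)) P ≤ e) :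
    ∀ (l : List V) (s : α), v ∈ l → failProb (run G (forEach step l s)) P ≤ e
  | w :: l, s, hv => by
    rw [forEach, run_bind]
    by_cases hl : v ∈ l
    · exact failProb_bind_le_sup fun a => failProb_forEach_le hP h l a hl
    · obtain rfl : v = w := by simpa [hl] using hv
      refine (failProb_bind_le (P := P) (e := 0) fun a ha => ?_).trans (by simpa using h s)
      exact (failProb_run_of_allOutputs G
        (allOutputs_forEach (I := fun _ => P) (fun w _ s hs => hP w s hs) l 0 a ha)).le

end Run

end OracleAlg

/-! ### The exploration -/

section Exploration

open OracleAlg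
open scoped ENNReal

variable {V : Type}

/-- The part `S` is contained in the part `T`. -/
def Explored.Sub (S T : Explored V) : Prop := S.verts ⊆ T.verts ∧ S.edges ⊆ T.edges

theorem Explored.sub_addAnswer [DecidableEq V] (v : V) (a : Option V) (S : Explored V) :
    S.Sub (S.addAnswer v a) := by
  cases a with
  | none => exact ⟨subset_rfl, subset_rfl⟩
  | some u => exact ⟨Finset.subset_insert _ _, Finset.subset_insert _ _⟩

theorem Explored.Sub.trans {S T U : Explored V} (h : S.Sub T) (h' : T.Sub U) : S.Sub U :=
  ⟨h.1.trans h'.1, h.2.trans h'.2⟩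

variable [DecidableEq V]

theorem allOutputs_innerLoop {P : Explored V → Prop} (hP : ∀ S T : Explored V, S.Sub T → P S → P T)
    (m : ℕ) (v : V) (S : Explored V) (hS : P S) : (innerLoop m v S).AllOutputs P :=
  allOutputs_repeatTimes (I := fun _ => P)
    (step := fun S : Explored V => .query v fun a => .done (S.addAnswer v a))
    (fun _ s hs a => hP _ _ (s.sub_addAnswer v a) hs) m 0 S hS

theorem allOutputs_middleLoop {P : Explored V → Prop}
    (hP : ∀ S T : Explored V, S.Sub T → P S → P T)
    (m : ℕ) (S : Explored V) (hS : P S) : (middleLoop m S).AllOutputs P :=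
  allOutputs_forEach (I := fun _ => P)
    (fun v _ s hs => allOutputs_innerLoop hP m v s hs) S.verts.toList 0 S hS

section Run

variable [Fintype V] [Nonempty V] (G : SimpleGraph V)

open Classical in
theorem failProb_neighbourOracle_le (v : V) {A : Finset V} (hA : ∀ a ∈ A, G.Adj v a)
    (hne : A.Nonempty) {c : ℝ} (hc : c * (G.neighborSet v).ncard ≤ A.card) :
    failProb (neighbourOracle G v) (fun o => ∃ a ∈ A, o = some a) ≤ ENNReal.ofReal (1 - c) := by
  have hsub : A ⊆ Finset.univ.filter fun u => G.Adj v u := fun a ha => by simpa using hA a ha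
  have hn : (Finset.univ.filter fun u => G.Adj v u).Nonempty := hne.mono hsub
  have hcard : (G.neighborSet v).ncard = (Finset.univ.filter fun u => G.Adj v u).card := by
    rw [← Set.ncard_coe_finset]; congr 1; ext; simp
  rw [neighbourOracle, dif_pos hn, failProb, PMF.toOuterMeasure_map_apply]
  refine le_trans (MeasureTheory.OuterMeasure.mono _ ?_)
    (failProb_uniformOfFinset_le hn hsub (c := c) (by rw [← hcard]; exact hc))
  intro a ha h
  exact ha ⟨a, h, rfl⟩

/-- The round makes `m` independent queries at `v`, each hitting `A` with probability at least `c`;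
all other queries only enlarge the explored part. -/
theorem failProb_middleLoop_le {m : ℕ} {S : Explored V} {v : V} (hv : v ∈ S.verts) {A : Finset V}
    (hA : ∀ a ∈ A, G.Adj v a) (hne : A.Nonempty) {c : ℝ}
    (hc : c * (G.neighborSet v).ncard ≤ A.card) :
    failProb (run G (middleLoop m S))
      (fun T => S.Sub T ∧ ∃ a ∈ A, a ∈ T.verts ∧ s(v, a) ∈ T.edges) ≤
      ENNReal.ofReal (1 - c) ^ m := by
  have hmono : ∀ S T : Explored V, S.Sub T → (∃ a ∈ A, a ∈ S.verts ∧ s(v, a) ∈ S.edges) →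
      ∃ a ∈ A, a ∈ T.verts ∧ s(v, a) ∈ T.edges :=
    fun S T h ⟨a, ha, h1, h2⟩ => ⟨a, ha, h.1 h1, h.2 h2⟩
  refine (failProb_and_le _ _ _).trans ?_
  rw [failProb_run_of_allOutputs G (allOutputs_middleLoop (P := fun T => S.Sub T)
    (fun T U h h' => h'.trans h) m S ⟨subset_rfl, subset_rfl⟩), zero_add]
  refine failProb_forEach_le G (fun w s hs => allOutputs_innerLoop hmono m w s hs) (v := v)
    (fun s => ?_) _ _ (by simpa using hv)
  refine failProb_repeatTimes_le_pow G (step := fun S : Explored V => .query v fun a => .done (S.addAnswer v a))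
    (fun s hs a => hmono _ _ (s.sub_addAnswer v a) hs) (fun s => ?_) m s
  refine (failProb_bind_le (P := fun o => ∃ a ∈ A, o = some a) (e := 0) ?_).trans
    (by simpa using failProb_neighbourOracle_le G v hA hne hc)
  rintro _ ⟨a, ha, rfl⟩
  refine (failProb_pure (P := fun T : Explored V =>
    ∃ a ∈ A, a ∈ T.verts ∧ s(v, a) ∈ T.edges) ?_).le
  exact ⟨a, ha, by simp [Explored.addAnswer], by simp [Explored.addAnswer]⟩

theorem failProb_initialSample_le (m : ℕ) {A : Finset V} {c : ℝ}
    (hc : c * Fintype.card V ≤ A.card) :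
    failProb (run G (initialSample m)) (fun S => ∃ a ∈ A, a ∈ S.verts) ≤
      ENNReal.ofReal (1 - c) ^ m := by
  refine failProb_repeatTimes_le_pow G ?_ (fun s => ?_) m _
  · rintro s ⟨a, ha, has⟩ v
    exact ⟨a, ha, Finset.mem_insert_of_mem has⟩
  · refine (failProb_bind_le (P := (· ∈ A)) (e := 0) fun a ha => ?_).trans ?_
    · exact (failProb_pure (P := fun S : Explored V => ∃ a ∈ A, a ∈ S.verts)
        ⟨a, ha, Finset.mem_insert_self _ _⟩).le
    · rw [add_zero, PMF.uniformOfFintype]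
      exact failProb_uniformOfFinset_le _ (Finset.subset_univ A) hc

/-- The explored edges are edges of the input graph. -/
theorem failProb_explore_sound (m₁ m₂ m₃ : ℕ) :
    failProb (run G (explore m₁ m₂ m₃)) (fun S => ∀ e ∈ S.edges, e ∈ G.edgeSet) = 0 := by
  classical
  set I : Explored V → Prop := fun S => ∀ e ∈ S.edges, e ∈ G.edgeSet with hI
  have hquery : ∀ v S, I S → failProb (run G
      (.query v fun a => .done (S.addAnswer v a) : OracleAlg V (Explored V))) I ≤ 0 := by
    intro v S hS
    refine (failProb_bind_le (P := fun o : Option V => ∀ u, o = some u → G.Adj v u)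
      (e := 0) fun o ho => ?_).trans ?_
    · refine (failProb_pure (P := I) ?_).le
      cases o with
      | none => exact hS
      | some u =>
        intro e he
        rcases Finset.mem_insert.1 he with rfl | he
        · exact ho u rfl
        · exact hS e he
    · rw [add_zero]
      by_cases hn : (Finset.univ.filter fun u => G.Adj v u).Nonempty
      · rw [neighbourOracle, dif_pos hn, failProb, PMF.toOuterMeasure_map_apply, nonpos_iff_eq_zero,
          PMF.toOuterMeasure_apply_eq_zero_iff, PMF.support_uniformOfFinset, Set.disjoint_left]
        intro u hu h
        apply h
        rintro w ⟨⟩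
        simpa using hu
      · rw [neighbourOracle, dif_neg hn]
        exact (failProb_pure (P := fun o : Option V => ∀ u, o = some u → G.Adj v u)
          (by simp)).le
  have hinner : ∀ v S, I S → failProb (run G (innerLoop m₃ v S)) I ≤ 0 := by
    intro v S hS
    exact (failProb_repeatTimes_le G (I := fun _ => I) (e := 0)
      (fun _ s hs => hquery v s hs) m₃ 0 S hS).trans (by simp)
  have hfor : ∀ (l : List V) S, I S → failProb (run G (forEach (innerLoop m₃) l S)) I ≤ 0 := by
    intro l
    induction l with
    | nil => exact fun S hS => (failProb_pure (P := I) hS).le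
    | cons v l ih =>
      intro S hS
      rw [forEach, run_bind]
      exact (failProb_bind_le (P := I) (e := 0) fun a ha => ih a ha).trans
        (by simpa using hinner v S hS)
  have hinit : (initialSample m₁ : OracleAlg V (Explored V)).AllOutputs I :=
    allOutputs_repeatTimes (I := fun _ => I) (step := fun S : Explored V => .sample fun v => .done (S.addVertex v))
      (fun _ s hs v => hs) m₁ 0 ⟨∅, ∅⟩ (by simp [hI])
  rw [← nonpos_iff_eq_zero, explore, run_bind]
  refine (failProb_bind_le (P := I) (e := 0) fun S hS => ?_).trans
    (by rw [failProb_run_of_allOutputs G hinit, add_zero])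
  exact (failProb_repeatTimes_le G (I := fun _ => I) (e := 0)
    (fun _ s hs => hfor _ s hs) m₂ 0 S hS).trans (by simp)

end Run

theorem isContained_of_edges_subset {W : Type*} {H : SimpleGraph W} {G : SimpleGraph V}
    {S : Explored V} (hS : ∀ e ∈ S.edges, e ∈ G.edgeSet) (h : H.IsContained S.graph) :
    H.IsContained G := by
  obtain ⟨f⟩ := h
  refine ⟨⟨⟨fun w => (f.toHom w : V), fun {a b} hab => ?_⟩, fun a b hab => ?_⟩⟩
  · have := f.toHom.map_rel hab
    simp only [Explored.graph, SimpleGraph.comap_adj, SimpleGraph.fromEdgeSet_adj] at this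
    exact hS _ this.1
  · exact f.injective' (Subtype.ext hab)

theorem tester_accept [Fintype V] [Nonempty V] {W : Type*} {H : SimpleGraph W}
    {G : SimpleGraph V} (hfree : H.Free G) (m₁ m₂ m₃ : ℕ) :
    run G ((explore m₁ m₂ m₃).bind fun S => .done (decideContains H S)) Verdict.accept = 1 := by
  have h := apply_add_failProb
    (run G ((explore m₁ m₂ m₃).bind fun S => .done (decideContains H S))) Verdict.accept
  have h0 : failProb (run G ((explore m₁ m₂ m₃).bind fun S => .done (decideContains H S)))
      (· = Verdict.accept) ≤ 0 := by
    rw [run_bind]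
    refine (failProb_bind_le (P := fun S => ∀ e ∈ S.edges, e ∈ G.edgeSet) (e := 0)
      fun S hS => ?_).trans (by rw [failProb_explore_sound, add_zero])
    refine (failProb_pure (P := (· = Verdict.accept)) ?_).le
    exact if_neg fun hc => hfree (isContained_of_edges_subset hS hc)
  rwa [nonpos_iff_eq_zero.1 h0, add_zero] at h

theorem tester_reject [Fintype V] [Nonempty V] {W : Type*} {H : SimpleGraph W}
    {G : SimpleGraph V} {m₁ m₂ m₃ : ℕ}
    (h : failProb (run G (explore m₁ m₂ m₃)) (fun S => H.IsContained S.graph) ≤ 1 / 3) :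
    2 / 3 ≤
      run G ((explore m₁ m₂ m₃).bind fun S => .done (decideContains H S)) Verdict.reject := by
  set μ := run G ((explore m₁ m₂ m₃).bind fun S => .done (decideContains H S)) with hμ
  have h1 := apply_add_failProb μ Verdict.reject
  have h0 : failProb μ (· = Verdict.reject) ≤ 1 / 3 := by
    rw [hμ, run_bind]
    refine (failProb_bind_le (P := fun S => H.IsContained S.graph) (e := 0)
      fun S hS => ?_).trans (by rwa [add_zero])
    exact (failProb_pure (P := (· = Verdict.reject)) (if_pos hS)).le
  have h2 : (2 / 3 : ℝ≥0∞) + 1 / 3 = 1 := by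
    rw [ENNReal.div_add_div_same, show (2 + 1 : ℝ≥0∞) = 3 by norm_num]
    exact ENNReal.div_self (by norm_num) (by norm_num)
  have h3 : (1 / 3 : ℝ≥0∞) ≠ ⊤ := by simp
  refine (ENNReal.add_le_add_iff_right h3).1 ?_
  rw [h2]
  exact h1.ge.trans (add_le_add_right h0 _)

/-- A bound for the number of queries of the exploration. -/
def queryBound (m₁ m₂ m₃ : ℕ) : ℕ :=
  ∑ i ∈ Finset.range m₂, m₁ * (1 + m₃) ^ i * m₃

theorem card_addAnswer_le (v : V) (S : Explored V) (a : Option V) :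
    (S.addAnswer v a).verts.card ≤ S.verts.card + 1 := by
  cases a with
  | none => exact Nat.le_succ _
  | some u => exact Finset.card_insert_le _ _

/-- Each explored vertex brings at most `m₃` new ones per round, so round `i` starts with at most
`m₁ * (1 + m₃) ^ i` vertices and makes `m₃` queries for each. -/
theorem queryComplexity_tester_le [Fintype V] {W : Type*} (H : SimpleGraph W) (m₁ m₂ m₃ : ℕ) :
    ((explore m₁ m₂ m₃ : OracleAlg V (Explored V)).bind
      fun S => .done (decideContains H S)).queryComplexity ≤ queryBound m₁ m₂ m₃ := by
  have hinner : ∀ v S k, S.verts.card ≤ k →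
      (innerLoop m₃ v S : OracleAlg V (Explored V)).AllOutputs (fun T => T.verts.card ≤ k + m₃) :=
    fun v S k hk => (allOutputs_repeatTimes
      (I := fun i (T : Explored V) => T.verts.card ≤ k + i)
      (step := fun S : Explored V => .query v fun a => .done (S.addAnswer v a))
      (fun i s hs a => (card_addAnswer_le v s a).trans (Nat.succ_le_succ hs)) m₃ 0 S hk).mono
        fun T hT => by simpa using hT
  have hinnerq : ∀ v S, (innerLoop m₃ v S : OracleAlg V (Explored V)).queryComplexity ≤ m₃ := by
    intro v S
    have := queryComplexity_repeatTimes_le (I := fun _ _ => True) (c := fun _ => 1)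
      (step := fun S : Explored V => .query v fun a => .done (S.addAnswer v a))
      (fun _ _ _ _ => trivial) (fun _ _ _ => by simp [queryComplexity]) m₃ 0 S trivial
    exact this.trans (by simp)
  have hmid : ∀ S k, S.verts.card ≤ k → (middleLoop m₃ S : OracleAlg V (Explored V)).AllOutputs
      (fun T => T.verts.card ≤ k * (1 + m₃)) := by
    intro S k hk
    refine (allOutputs_forEach (I := fun i (T : Explored V) => T.verts.card ≤ k + i * m₃)
      (fun v i s hs => (hinner v s _ hs).mono fun T hT => ?_) S.verts.toList 0 S
      (by simpa using hk)).mono fun T hT => ?_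
    · rw [add_mul, one_mul, ← add_assoc]; exact hT
    · rw [Finset.length_toList, zero_add] at hT
      nlinarith [Nat.mul_le_mul_right m₃ hk]
  have hinit : (initialSample m₁ : OracleAlg V (Explored V)).AllOutputs
      (fun T => T.verts.card ≤ m₁) := by
    have := allOutputs_repeatTimes (I := fun i (T : Explored V) => T.verts.card ≤ i)
      (step := fun S : Explored V => (.sample fun v => .done (S.addVertex v) : OracleAlg V (Explored V)))
      (fun i s hs v => (Finset.card_insert_le v s.verts).trans (Nat.succ_le_succ hs)) m₁ 0 ⟨∅, ∅⟩
      (by simp)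
    rw [zero_add] at this
    exact this
  have hinitq : (initialSample m₁ : OracleAlg V (Explored V)).queryComplexity ≤ 0 := by
    have := queryComplexity_repeatTimes_le (I := fun _ _ => True) (c := fun _ => 0)
      (step := fun S : Explored V => (.sample fun v => .done (S.addVertex v) : OracleAlg V (Explored V)))
      (fun _ _ _ _ => trivial) (fun _ _ _ => by simp [queryComplexity]) m₁ 0 ⟨∅, ∅⟩ trivial
    exact this.trans (by simp)
  have hexp : (explore m₁ m₂ m₃ : OracleAlg V (Explored V)).queryComplexity
      ≤ queryBound m₁ m₂ m₃ := by
    refine (queryComplexity_bind_le (fun S hS => ?_) hinit).trans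
      (by rw [nonpos_iff_eq_zero.1 hinitq, zero_add])
    refine (queryComplexity_repeatTimes_le
      (I := fun i (T : Explored V) => T.verts.card ≤ m₁ * (1 + m₃) ^ i)
      (c := fun i => m₁ * (1 + m₃) ^ i * m₃) (fun i s hs => ?_) (fun i s hs => ?_) m₂ 0 S
      (by simpa using hS)).trans (by simp [queryBound])
    · rw [pow_succ, ← mul_assoc]; exact hmid s _ hs
    · refine (queryComplexity_forEach_le hinnerq _ _).trans ?_
      rw [Finset.length_toList]
      exact Nat.mul_le_mul_right _ hs
  refine (queryComplexity_bind_le (c := 0) (fun _ _ => le_rfl) (allOutputs_true _)).trans ?_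
  simpa using hexp

end Exploration

/-! ### Consequences of admissibility -/

section Admissible

variable {V : Type*} [LinearOrder V] {G : SimpleGraph V} {p r : ℕ}

theorem IsAdmissiblePath.end_mem_tail {v x : V} {P : G.Walk v x} (hP : IsAdmissiblePath G r P) :
    x ∈ P.support.tail := by
  cases P with
  | nil => exact absurd hP.2.1 (lt_irrefl _)
  | cons h q => simp

theorem encard_le_of_isPathPacking (hadm : orderedAdm G r ≤ p) {v : V}
    {S : Set (Σ x : V, G.Walk v x)} (hS : IsPathPacking G r v S) : S.encard ≤ p :=
  le_trans (le_trans (le_iSup₂_of_le S hS le_rfl) (le_iSup (packingNumber G r) v)) hadm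

/-- All admissible paths from `v` meet a bounded set outside of `v`. -/
theorem exists_hitting_set (hadm : orderedAdm G r ≤ p) (v : V) :
    ∃ B : Finset V, B.card ≤ p * r ∧ ∀ (x : V) (P : G.Walk v x), IsAdmissiblePath G r P →
      ∃ y ∈ B, y ∈ P.support.tail := by
  classical
  by_contra! hno
  -- Greedy packing: `B` covers the non-root vertices of the paths chosen so far, so a path missed
  -- by `B` can be added. Reaching `p + 1` paths contradicts admissibility.
  have key : ∀ m ≤ p + 1, ∃ (S : Finset (Σ x : V, G.Walk v x)) (B : Finset V), S.card = m ∧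
      IsPathPacking G r v (S : Set (Σ x : V, G.Walk v x)) ∧ B.card ≤ m * r ∧
      ∀ P ∈ S, ∀ y ∈ P.2.support.tail, y ∈ B := by
    intro m
    induction m with
    | zero => exact fun _ => ⟨∅, ∅, rfl, ⟨by simp, by simp⟩, by simp, by simp⟩
    | succ m ih =>
      intro hm
      obtain ⟨S, B, hS, hpack, hB, hSB⟩ := ih (by omega)
      obtain ⟨x, P, hP, hPB⟩ := hno B (hB.trans (Nat.mul_le_mul_right r (by omega)))
      have hnew : (⟨x, P⟩ : Σ x : V, G.Walk v x) ∉ S := fun hmem =>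
        hPB x (hSB _ hmem x hP.end_mem_tail) hP.end_mem_tail
      refine ⟨insert ⟨x, P⟩ S, B ∪ P.support.tail.toFinset, ?_, ⟨?_, ?_⟩, ?_, ?_⟩
      · rw [Finset.card_insert_of_notMem hnew, hS]
      · intro Q hQ
        rcases Finset.mem_insert.1 (Finset.mem_coe.1 hQ) with rfl | hQ
        · exact hP
        · exact hpack.1 Q hQ
      · intro Q hQ R hR hQR
        rcases Finset.mem_insert.1 (Finset.mem_coe.1 hQ) with rfl | hQ <;>
          rcases Finset.mem_insert.1 (Finset.mem_coe.1 hR) with rfl | hR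
        · exact absurd rfl hQR
        · exact fun y hy hy' => hPB y (hSB R hR y hy') hy
        · exact fun y hy hy' => hPB y (hSB Q hQ y hy) hy'
        · exact hpack.2 Q hQ R hR hQR
      · have h1 : P.support.tail.length ≤ r := by simpa using hP.2.2.2
        have h2 := List.toFinset_card_le P.support.tail
        have h3 := Finset.card_union_le B P.support.tail.toFinset
        rw [Nat.succ_mul]
        omega
      · intro Q hQ y hy
        rcases Finset.mem_insert.1 hQ with rfl | hQ
        · exact Finset.mem_union_right _ (by simpa using hy)
        · exact Finset.mem_union_left _ (hSB Q hQ y hy)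
  obtain ⟨S, -, hS, hpack, -⟩ := key (p + 1) le_rfl
  have := encard_le_of_isPathPacking hadm hpack
  rw [Set.encard_coe_eq_coe_finsetCard, hS] at this
  have h := (Nat.cast_le (α := ℕ∞)).1 this
  omega

/-- Since `1 ≤ r`, the single edges from `v` to its earlier neighbours form an admissible path
packing. -/
theorem ncard_smaller_neighbors_le [Finite V] (hr : 1 ≤ r) (hadm : orderedAdm G r ≤ p) (v : V) :
    {z | G.Adj v z ∧ z < v}.ncard ≤ p := by
  set S : Set (Σ x : V, G.Walk v x) :=
    {P | ∃ (z : V) (h : G.Adj v z), z < v ∧ P = ⟨z, h.toWalk⟩} with hS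
  have hpack : IsPathPacking G r v S := by
    refine ⟨?_, ?_⟩
    · rintro _ ⟨z, h, hz, rfl⟩
      refine ⟨?_, hz, ?_, by simpa using hr⟩
      · simp [hz.ne']
      · intro w hw h1 h2
        simp at hw
        tauto
    · rintro _ ⟨z, h, hz, rfl⟩ _ ⟨z', h', hz', rfl⟩ hne
      simp only [SimpleGraph.Walk.support_cons, SimpleGraph.Walk.support_nil, List.tail_cons,
        List.disjoint_singleton, List.mem_singleton]
      rintro rfl
      exact hne rfl
  have h1 : {z | G.Adj v z ∧ z < v} ⊆ Sigma.fst '' S :=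
    fun z hz => ⟨⟨z, hz.1.toWalk⟩, ⟨z, hz.1, hz.2, rfl⟩, rfl⟩
  have h2 := ((Set.encard_le_encard h1).trans (Set.encard_image_le _ _)).trans
    (encard_le_of_isPathPacking hadm hpack)
  rw [← (Set.toFinite {z | G.Adj v z ∧ z < v}).cast_ncard_eq] at h2
  exact_mod_cast h2

end Admissible

/-! ### Copies and their branches -/

/-- The map `ψ` is a copy of `H` in `G`. -/
def IsCopy {V W : Type*} (H : SimpleGraph W) (G : SimpleGraph V) (ψ : W → V) : Prop :=
  Function.Injective ψ ∧ ∀ x y, H.Adj x y → G.Adj (ψ x) (ψ y)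

theorem IsCopy.mono {V W : Type*} {H : SimpleGraph W} {G G' : SimpleGraph V} {ψ : W → V}
    (h : IsCopy H G ψ) (hle : G ≤ G') : IsCopy H G' ψ :=
  ⟨h.1, fun x y hxy => hle (h.2 x y hxy)⟩

theorem exists_isCopy {V W : Type*} {H : SimpleGraph W} {G : SimpleGraph V}
    (h : H.IsContained G) : ∃ ψ, IsCopy H G ψ := by
  obtain ⟨f⟩ := h
  exact ⟨f.toHom, f.injective', fun x y hxy => f.toHom.map_rel hxy⟩

/-- The vertices that can be reached from `h` in `H` while avoiding `D`. -/
def branch {W : Type*} (H : SimpleGraph W) (D : Set W) (h : W) : Set W :=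
  {z | Relation.ReflTransGen (fun a b => H.Adj a b ∧ b ∉ D) h z}

section Branch

variable {V W : Type*} {H : SimpleGraph W} {D : Set W} {h : W}

theorem mem_branch_self : h ∈ branch H D h := Relation.ReflTransGen.refl

theorem notMem_of_mem_branch (hh : h ∉ D) {z : W} (hz : z ∈ branch H D h) : z ∉ D := by
  cases hz with
  | refl => exact hh
  | tail _ h => exact h.2

theorem mem_branch_of_adj {x y : W} (hx : x ∈ branch H D h) (hxy : H.Adj x y) (hy : y ∉ D) :
    y ∈ branch H D h :=
  Relation.ReflTransGen.tail hx ⟨hxy, hy⟩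

/-- Exchanging a branch of a copy. -/
theorem IsCopy.swap {G : SimpleGraph V} {ψ ψ' : W → V} (hψ : IsCopy H G ψ) (hψ' : IsCopy H G ψ')
    (hD : ∀ w ∈ D, ψ w = ψ' w)
    (havoid : ∀ w ∈ branch H D h, ∀ z ∉ branch H D h, ψ' w ≠ ψ z) :
    ∃ φ, IsCopy H G φ ∧ (∀ w ∈ branch H D h, φ w = ψ' w) ∧ ∀ w ∉ branch H D h, φ w = ψ w := by
  classical
  refine ⟨fun w => if w ∈ branch H D h then ψ' w else ψ w, ⟨?_, ?_⟩, fun w hw => if_pos hw,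
    fun w hw => if_neg hw⟩
  · intro x y hxy
    by_cases hx : x ∈ branch H D h <;> by_cases hy : y ∈ branch H D h <;>
      simp only [hx, hy, if_true, if_false] at hxy
    · exact hψ'.1 hxy
    · exact absurd hxy (havoid x hx y hy)
    · exact absurd hxy.symm (havoid y hy x hx)
    · exact hψ.1 hxy
  -- An edge that leaves the branch ends in `D`, where the two copies agree.
  · have key : ∀ x y, x ∈ branch H D h → y ∉ branch H D h → H.Adj x y → ψ y = ψ' y := by
      intro x y hx hy hxy
      by_contra hne
      exact hy (mem_branch_of_adj hx hxy fun hyD => hne (hD y hyD))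
    intro x y hxy
    by_cases hx : x ∈ branch H D h <;> by_cases hy : y ∈ branch H D h <;>
      simp only [hx, hy, if_true, if_false]
    · exact hψ'.2 x y hxy
    · rw [key x y hx hy hxy]; exact hψ'.2 x y hxy
    · rw [key y x hy hx hxy.symm]; exact hψ'.2 x y hxy
    · exact hψ.2 x y hxy

/-- A branch that contains a vertex before the root contains an admissible path. -/
theorem exists_admissible_path_of_low [LinearOrder V] [Fintype W] {G : SimpleGraph V} {r : ℕ}
    (hW : Fintype.card W ≤ r) {ψ : W → V} (hψ : IsCopy H G ψ) {k : W} (hkh : H.Adj k h)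
    {z : W} (hz : z ∈ branch H D h) (hlow : ψ z < ψ k) :
    ∃ (x : V) (P : G.Walk (ψ k) x), IsAdmissiblePath G r P ∧
      ∀ y ∈ P.support.tail, ∃ w ∈ branch H D h, ψ w = y := by
  classical
  have hwalk : ∀ z ∈ branch H D h, ∃ P : G.Walk (ψ k) (ψ z),
      ∀ y ∈ P.support, y = ψ k ∨ ∃ w ∈ branch H D h, ψ w = y := by
    intro z hz
    induction hz with
    | refl =>
      refine ⟨(hψ.2 _ _ hkh).toWalk, ?_⟩
      intro y hy
      simp at hy
      rcases hy with rfl | rfl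
      · exact Or.inl rfl
      · exact Or.inr ⟨h, mem_branch_self, rfl⟩
    | @tail b c hb hbc ih =>
      obtain ⟨P, hP⟩ := ih
      refine ⟨P.concat (hψ.2 _ _ hbc.1), ?_⟩
      intro y hy
      rw [SimpleGraph.Walk.support_concat] at hy
      simp at hy
      rcases hy with hy | rfl
      · exact hP y hy
      · exact Or.inr ⟨c, Relation.ReflTransGen.tail hb hbc, rfl⟩
  -- A shortest path to any vertex before the root is taken. An inner vertex before the root would
  -- give a shorter one.
  have hex : ∃ n, ∃ (x : V) (P : G.Walk (ψ k) x), P.IsPath ∧ x < ψ k ∧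
      (∀ y ∈ P.support, y = ψ k ∨ ∃ w ∈ branch H D h, ψ w = y) ∧ P.length = n := by
    obtain ⟨P, hP⟩ := hwalk z hz
    exact ⟨_, _, P.bypass, P.bypass_isPath, hlow,
      fun y hy => hP y (P.support_bypass_subset_support hy), rfl⟩
  obtain ⟨x, P, hpath, hx, hsupp, hlen⟩ := Nat.find_spec hex
  have hmin := fun m => Nat.find_min hex (m := m)
  rw [← hlen] at hmin
  have htail : ∀ y ∈ P.support.tail, ∃ w ∈ branch H D h, ψ w = y := by
    intro y hy
    have hnd := hpath.support_nodup
    rw [← SimpleGraph.Walk.cons_tail_support, List.nodup_cons] at hnd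
    rcases hsupp y (List.mem_of_mem_tail hy) with rfl | h
    · exact absurd hy hnd.1
    · exact h
  refine ⟨x, P, ⟨hpath, hx, ?_, ?_⟩, htail⟩
  · intro w hw hwk hwx
    by_contra hlt
    have hlt' : w < ψ k := lt_of_le_of_ne (not_lt.1 hlt) hwk
    refine hmin (P.takeUntil w hw).length (P.length_takeUntil_lt_length hw hwx)
      ⟨w, P.takeUntil w hw, hpath.takeUntil hw, hlt', fun y hy => ?_, rfl⟩
    exact hsupp y (P.support_takeUntil_subset_support hw hy)
  -- The length is at most `r` because the non-root vertices of the path are distinct images of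
  -- vertices of `H`.
  · have hnd : P.support.tail.Nodup := hpath.support_nodup.tail
    have h1 : P.support.tail.toFinset ⊆ Finset.univ.image ψ := by
      intro y hy
      obtain ⟨w, -, rfl⟩ := htail y (by simpa using hy)
      simp
    have h2 := Finset.card_le_card h1
    rw [List.toFinset_card_of_nodup hnd] at h2
    have h3 : (Finset.univ.image ψ).card ≤ Fintype.card W := Finset.card_image_le
    have h4 : P.support.tail.length = P.length := by simp
    omega

end Branch

/-! ### Pruning -/

/-- A family of partially prescribed copies of `H`: the vertex `k` is mapped to `root`, the
assignments of the list `fixed` are respected, and the neighbour `h` of `k` is to be exchanged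
together with its branch. If `low` holds, then the branch has to contain a vertex that is mapped
before `root`. -/
structure CopyType (V W : Type*) where
  root : V
  k : W
  h : W
  low : Bool
  fixed : List (W × V)

namespace CopyType

variable {V W : Type*}

/-- The vertices of `H` with prescribed images. -/
def dom (x : CopyType V W) : Set W := {w | w = x.k ∨ w ∈ x.fixed.map Prod.fst}

/-- The copies of a given type. -/
def Fits [LT V] (H : SimpleGraph W) (G : SimpleGraph V) (x : CopyType V W) (ψ : W → V) : Prop :=
  IsCopy H G ψ ∧ ψ x.k = x.root ∧ (∀ q ∈ x.fixed, ψ q.1 = q.2) ∧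
    (x.low = true → ∃ z ∈ branch H x.dom x.h, ψ z < x.root)

theorem Fits.mono [LT V] {H : SimpleGraph W} {G G' : SimpleGraph V} {x : CopyType V W} {ψ : W → V}
    (h : x.Fits H G ψ) (hle : G ≤ G') : x.Fits H G' ψ :=
  ⟨h.1.mono hle, h.2⟩

/-- The list of assignments has no last entry, or this entry comes from the set `B` of a member
of `M`. -/
def Eligible (M : Set (CopyType V W)) (B : CopyType V W → Finset V) (x : CopyType V W) : Prop :=
  x.fixed = [] ∨ ∃ (w : W) (y : V) (l : List (W × V)) (low : Bool), x.fixed = (w, y) :: l ∧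
    (⟨x.root, x.k, x.h, low, l⟩ : CopyType V W) ∈ M ∧ y ∈ B ⟨x.root, x.k, x.h, low, l⟩

/-- Outside of every small set, copies of the type use many neighbours of the root. -/
def Robust [LT V] (H : SimpleGraph W) (G : SimpleGraph V) (b : ℕ) (c : ℝ) (x : CopyType V W) :
    Prop :=
  ∀ B : Finset V, B.card ≤ b →
    c < ({a | ∃ ψ, x.Fits H G ψ ∧ ψ x.h = a ∧ ∀ w ∈ branch H x.dom x.h, ψ w ∉ B}.ncard : ℝ)

end CopyType

/-- The graph `G'` arises from `G` by deleting edges, such that for each type in `M` all copies in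
`G'` meet the small set `B`. -/
structure Pruning {V W : Type*} [LT V] (H : SimpleGraph W) (G : SimpleGraph V)
    (d : V → ℝ) (b r : ℕ) (δ : ℝ) (G' : SimpleGraph V) (M : Finset (CopyType V W))
    (B : CopyType V W → Finset V) : Prop where
  le : G' ≤ G
  card_le : ∀ x, (B x).card ≤ b
  heavy : ∀ x ∈ M, δ < d x.root
  length_le : ∀ x ∈ M, x.fixed.length ≤ r
  eligible : ∀ x ∈ M, x.Eligible M B
  meets : ∀ x ∈ M, ∀ ψ, x.Fits H G' ψ →
    ψ x.h ∉ B x ∧ ∃ w ∈ branch H x.dom x.h, ψ w ∈ B x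
  cost : ((G.edgeSet \ G'.edgeSet).ncard : ℝ) ≤ ∑ x ∈ M, (1 + b) * d x.root / δ

section

variable {V W : Type*} [Fintype V] [Fintype W] [LinearOrder V] {H : SimpleGraph W}
  {G G' : SimpleGraph V} {d : V → ℝ} {b r : ℕ} {δ : ℝ}
  {M : Finset (CopyType V W)} {B : CopyType V W → Finset V}

/-- The number of types with a given root in a pruning is at most this number. -/
def typeBound (w b r : ℕ) : ℕ := 2 * w ^ 2 * ∑ j ∈ Finset.range (r + 1), (2 * w * b) ^ j

open Classical in
/-- The lists of assignments of length `j` that occur in a pruning. -/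
noncomputable def fixedLists (M : Finset (CopyType V W)) (v : V) (k h : W) (j : ℕ) :
    Finset (List (W × V)) :=
  (M.filter fun x => x.root = v ∧ x.k = k ∧ x.h = h ∧ x.fixed.length = j).image CopyType.fixed

theorem mem_fixedLists {v : V} {k h : W} {j : ℕ} {l : List (W × V)} :
    l ∈ fixedLists M v k h j ↔ ∃ low, (⟨v, k, h, low, l⟩ : CopyType V W) ∈ M ∧ l.length = j := by
  classical
  simp only [fixedLists, Finset.mem_image, Finset.mem_filter]
  constructor
  · rintro ⟨⟨v', k', h', low, l'⟩, ⟨hM, rfl, rfl, rfl, rfl⟩, rfl⟩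
    exact ⟨low, hM, rfl⟩
  · rintro ⟨low, hM, rfl⟩
    exact ⟨_, ⟨hM, rfl, rfl, rfl, rfl⟩, rfl⟩

theorem Pruning.card_fixedLists_le (hP : Pruning H G d b r δ G' M B) (v : V) (k h : W) (j : ℕ) :
    (fixedLists M v k h j).card ≤ (2 * Fintype.card W * b) ^ j := by
  classical
  induction j with
  | zero =>
    refine (Finset.card_le_card (t := {[]}) fun l hl => ?_).trans (by simp)
    obtain ⟨low, -, hl⟩ := mem_fixedLists.1 hl
    simpa using hl
  | succ j ih =>
    -- By eligibility a list extends a shorter occurring list by a vertex of `W` and an element of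
    -- `B`. Lists do not record the flag of their predecessor, so the sets `B` of both flags are
    -- joined; this is the factor 2.
    have hsub : fixedLists M v k h (j + 1) ⊆ (fixedLists M v k h j).biUnion fun l =>
        ((Finset.univ : Finset W) ×ˢ (B ⟨v, k, h, true, l⟩ ∪ B ⟨v, k, h, false, l⟩)).image
          fun q => q :: l := by
      intro l hl
      obtain ⟨low, hM, hlen⟩ := mem_fixedLists.1 hl
      rcases hP.eligible _ hM with h0 | ⟨w, y, l', low', hl', hM', hy⟩
      · simp only at h0
        simp [h0] at hlen
      · simp only at hl' hM' hy
        rw [Finset.mem_biUnion]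
        refine ⟨l', mem_fixedLists.2 ⟨low', hM', by simpa [hl'] using hlen⟩, ?_⟩
        rw [Finset.mem_image]
        refine ⟨(w, y), ?_, hl'.symm⟩
        rw [Finset.mem_product, Finset.mem_union]
        cases low'
        · exact ⟨Finset.mem_univ _, Or.inr hy⟩
        · exact ⟨Finset.mem_univ _, Or.inl hy⟩
    refine (Finset.card_le_card hsub).trans ?_
    refine (Finset.card_biUnion_le_card_mul _ _ (2 * Fintype.card W * b) fun l _ => ?_).trans ?_
    · refine Finset.card_image_le.trans ?_
      rw [Finset.card_product, Finset.card_univ]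
      have h1 := Finset.card_union_le (B ⟨v, k, h, true, l⟩) (B ⟨v, k, h, false, l⟩)
      have h2 := hP.card_le ⟨v, k, h, true, l⟩
      have h3 := hP.card_le ⟨v, k, h, false, l⟩
      calc Fintype.card W * _ ≤ Fintype.card W * (2 * b) := Nat.mul_le_mul_left _ (by omega)
        _ = _ := by ring
    · rw [pow_succ]
      exact Nat.mul_le_mul_right _ ih

open Classical in
theorem Pruning.card_filter_root_le (hP : Pruning H G d b r δ G' M B) (v : V) :
    (M.filter fun x => x.root = v).card ≤ typeBound (Fintype.card W) b r := by
  have hsub : (M.filter fun x => x.root = v) ⊆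
      (Finset.univ : Finset (Bool × W × W)).biUnion fun q =>
        (Finset.range (r + 1)).biUnion fun j =>
          (fixedLists M v q.2.1 q.2.2 j).image fun l => ⟨v, q.2.1, q.2.2, q.1, l⟩ := by
    rintro ⟨v', k, h, low, l⟩ hx
    obtain ⟨hM, rfl⟩ := Finset.mem_filter.1 hx
    simp only [Finset.mem_biUnion, Finset.mem_image, Finset.mem_range, Finset.mem_univ, true_and]
    exact ⟨(low, k, h), l.length, Nat.lt_succ_of_le (hP.length_le _ hM), l,
      mem_fixedLists.2 ⟨low, hM, rfl⟩, rfl⟩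
  refine (Finset.card_le_card hsub).trans ?_
  refine (Finset.card_biUnion_le_card_mul _ _ _ fun q _ => Finset.card_biUnion_le.trans
    (Finset.sum_le_sum fun j _ => Finset.card_image_le.trans
      (hP.card_fixedLists_le v q.2.1 q.2.2 j))).trans (le_of_eq ?_)
  simp only [Finset.card_univ, Fintype.card_prod, Fintype.card_bool, typeBound]
  ring

theorem Pruning.card_le_typeBound (hP : Pruning H G d b r δ G' M B) :
    M.card ≤ Fintype.card V * typeBound (Fintype.card W) b r := by
  classical
  rw [Finset.card_eq_sum_card_fiberwise (f := CopyType.root) (t := Finset.univ)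
    (fun _ _ => Finset.mem_coe.2 (Finset.mem_univ _))]
  refine (Finset.sum_le_card_nsmul _ _ _ fun v _ => hP.card_filter_root_le v).trans (le_of_eq ?_)
  simp

theorem Pruning.cost_le (hP : Pruning H G d b r δ G' M B) (hδ : 0 < δ) (hd : ∀ v, 0 ≤ d v) :
    ((G.edgeSet \ G'.edgeSet).ncard : ℝ) ≤
      typeBound (Fintype.card W) b r * (1 + b) * (∑ v, d v) / δ := by
  classical
  refine hP.cost.trans ?_
  rw [← Finset.sum_fiberwise_of_maps_to (s := M) (t := Finset.univ) (g := CopyType.root)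
    (fun _ _ => Finset.mem_univ _), mul_div_assoc, Finset.sum_div, Finset.mul_sum]
  refine Finset.sum_le_sum fun v _ => ?_
  have h1 : ∑ x ∈ M.filter (fun x => x.root = v), (1 + b) * d x.root / δ =
      (M.filter fun x => x.root = v).card * ((1 + b) * d v / δ) := by
    rw [← nsmul_eq_mul, ← Finset.sum_const]
    exact Finset.sum_congr rfl fun x hx => by rw [(Finset.mem_filter.1 hx).2]
  rw [h1, mul_assoc, ← mul_div_assoc (1 + (b : ℝ))]
  refine mul_le_mul_of_nonneg_right ?_ (div_nonneg (mul_nonneg (by positivity) (hd v)) hδ.le)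
  exact_mod_cast hP.card_filter_root_le v

/-- Failure of robustness provides a small set `B₀` and a small set `A` of those neighbours of the
root that serve as the image of `h` in copies whose branch avoids `B₀`. Without the edges from the
root to `A`, the branch of every copy of type `x` meets `B₀`. -/
theorem Pruning.extend (hP : Pruning H G d b r δ G' M B) (hδ : 0 < δ) {x : CopyType V W}
    (hx : x ∉ M) (hel : x.Eligible M B) (hlen : x.fixed.length ≤ r) (hheavy : δ < d x.root)
    (hadj : H.Adj x.k x.h) (hrob : ¬ x.Robust H G' b (d x.root / δ)) :
    ∃ G'' M' B', Pruning H G d b r δ G'' M' B' ∧ M'.card = M.card + 1 := by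
  classical
  unfold CopyType.Robust at hrob
  push Not at hrob
  obtain ⟨B₀, hB₀, hA⟩ := hrob
  set A := {a | ∃ ψ, x.Fits H G' ψ ∧ ψ x.h = a ∧ ∀ w ∈ branch H x.dom x.h, ψ w ∉ B₀} with hAdef
  set S : Set V := A ∪ B₀ with hS
  -- The edges from the root to `B₀` are deleted too. This keeps the image of `h` out of `B₀`, so
  -- that a vertex prescribed later is never `h` itself.
  set G'' := G'.deleteEdges ((fun a => s(x.root, a)) '' S) with hG''
  have hle : G'' ≤ G' := SimpleGraph.deleteEdges_le _
  have hB : ∀ y ∈ M, Function.update B x B₀ y = B y := fun y hy =>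
    Function.update_of_ne (fun h : y = x => hx (h ▸ hy)) _ _
  have helig : ∀ y : CopyType V W, y.Eligible M B →
      y.Eligible (insert x M : Finset (CopyType V W)) (Function.update B x B₀) := by
    rintro y (h | ⟨w, z, l, low, h1, h2, h3⟩)
    · exact Or.inl h
    · refine Or.inr ⟨w, z, l, low, h1, Finset.mem_coe.2 (Finset.mem_insert_of_mem h2), ?_⟩
      rwa [hB _ h2]
  refine ⟨G'', insert x M, Function.update B x B₀, ⟨hle.trans hP.le, ?_, ?_, ?_, ?_, ?_, ?_⟩,
    Finset.card_insert_of_notMem hx⟩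
  · intro y
    by_cases hy : y = x
    · subst hy; simpa using hB₀
    · rw [Function.update_of_ne hy]; exact hP.card_le y
  · intro y hy
    rcases Finset.mem_insert.1 hy with rfl | hy
    · exact hheavy
    · exact hP.heavy y hy
  · intro y hy
    rcases Finset.mem_insert.1 hy with rfl | hy
    · exact hlen
    · exact hP.length_le y hy
  · intro y hy
    rcases Finset.mem_insert.1 hy with rfl | hy
    · exact helig _ hel
    · exact helig _ (hP.eligible y hy)
  · intro y hy ψ hψ
    rcases Finset.mem_insert.1 hy with rfl | hy
    · rw [Function.update_self]
      have h1 : ψ y.h ∉ S := by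
        have := hψ.1.2 _ _ hadj
        rw [hψ.2.1, hG'', SimpleGraph.deleteEdges_adj] at this
        exact fun h => this.2 ⟨_, h, rfl⟩
      refine ⟨fun h => h1 (Or.inr h), ?_⟩
      by_contra! hno
      exact h1 (Or.inl ⟨ψ, hψ.mono hle, rfl, hno⟩)
    · rw [hB y hy]
      exact hP.meets y hy ψ (hψ.mono hle)
  · rw [Finset.sum_insert hx]
    have hsub : G.edgeSet \ G''.edgeSet ⊆
        ((fun a => s(x.root, a)) '' S) ∪ (G.edgeSet \ G'.edgeSet) := by
      rintro e ⟨he, hne⟩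
      by_cases h : e ∈ G'.edgeSet
      · left
        by_contra hs
        exact hne (by rw [hG'', SimpleGraph.edgeSet_deleteEdges]; exact ⟨h, hs⟩)
      · exact Or.inr ⟨he, h⟩
    have h1 := (Set.ncard_le_ncard hsub (Set.toFinite _)).trans (Set.ncard_union_le _ _)
    have h2 : ((fun a => s(x.root, a)) '' S).ncard ≤ A.ncard + b := by
      refine (Set.ncard_image_le (Set.toFinite _)).trans ((Set.ncard_union_le _ _).trans ?_)
      rw [Set.ncard_coe_finset]
      omega
    have h3 : ((G.edgeSet \ G''.edgeSet).ncard : ℝ) ≤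
        (A.ncard + b) + (G.edgeSet \ G'.edgeSet).ncard := by
      exact_mod_cast h1.trans (Nat.add_le_add_right h2 _)
    -- Only heavy roots are treated, so the up to `b` edges to `B₀` are paid by `b * (d x.root /
    -- δ)`; hence the factor `1 + b` in the cost.
    have h4 : (1 : ℝ) ≤ d x.root / δ := by rw [le_div_iff₀ hδ]; linarith
    have h5 : (1 + (b : ℝ)) * d x.root / δ = d x.root / δ + b * (d x.root / δ) := by ring
    have h6 : (b : ℝ) ≤ b * (d x.root / δ) := le_mul_of_one_le_right (by positivity) h4
    rw [h5]
    linarith [hP.cost]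

/-- A pruning in which every eligible type that has not been treated is robust. -/
theorem exists_maximal_pruning (H : SimpleGraph W) (G : SimpleGraph V) (d : V → ℝ) (b r : ℕ)
    (hδ : 0 < δ) :
    ∃ G' M B, Pruning H G d b r δ G' M B ∧ ∀ x ∉ M, x.Eligible M B → x.fixed.length ≤ r →
      δ < d x.root → H.Adj x.k x.h → x.Robust H G' b (d x.root / δ) := by
  classical
  -- The number of types in a pruning is bounded, so one with the most types exists, and it cannot
  -- be extended.
  set P : ℕ → Prop := fun m => ∃ G' M B, Pruning H G d b r δ G' M B ∧ M.card = m with hPdef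
  have h0 : P 0 := ⟨G, ∅, fun _ => ∅, ⟨le_rfl, by simp, by simp, by simp, by simp, by simp,
    by simp⟩, rfl⟩
  have hspec := Nat.findGreatest_spec (P := P)
    (Nat.zero_le (Fintype.card V * typeBound (Fintype.card W) b r)) h0
  obtain ⟨G', M, B, hP, hcard⟩ := hspec
  refine ⟨G', M, B, hP, fun x hx hel hlen hheavy hadj => ?_⟩
  by_contra hrob
  obtain ⟨G'', M', B', hP', hM'⟩ := hP.extend hδ hx hel hlen hheavy hadj hrob
  have := Nat.le_findGreatest (P := P) hP'.card_le_typeBound (⟨G'', M', B', hP', rfl⟩ : P M'.card)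
  omega

end

/-! ### Rerouting copies in a maximal pruning -/

/-- Every copy of `H` in `G'` can be rerouted, while keeping any part of it, through a `1 / δ`
fraction of the neighbours in `G` of some vertex of this part. -/
def Reroutable {V W : Type*} (H : SimpleGraph W) (G G' : SimpleGraph V) (δ : ℝ) : Prop :=
  ∀ ψ : W → V, IsCopy H G' ψ → ∀ F : Finset W, F.Nonempty → (∃ w, w ∉ F) →
    ∃ k ∈ F, ∃ h ∉ F, ∃ A : Finset V, A.Nonempty ∧ (∀ a ∈ A, G.Adj (ψ k) a) ∧
      ((G.neighborSet (ψ k)).ncard : ℝ) ≤ δ * A.card ∧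
      ∀ a ∈ A, ∃ ψ', IsCopy H G' ψ' ∧ (∀ w ∈ F, ψ' w = ψ w) ∧ ψ' h = a

theorem exists_adj_of_connected {W : Type*} {H : SimpleGraph W} (hH : H.Connected) {F : Finset W}
    (hF : F.Nonempty) (hF' : ∃ w, w ∉ F) : ∃ k ∈ F, ∃ h ∉ F, H.Adj k h := by
  obtain ⟨x, hx⟩ := hF
  obtain ⟨y, hy⟩ := hF'
  obtain ⟨P⟩ := hH.preconnected x y
  obtain ⟨d, -, h1, h2⟩ := P.exists_boundary_dart (F : Set W) hx hy
  exact ⟨d.fst, h1, d.snd, h2, d.adj⟩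

section

variable {V W : Type*} [Fintype V] [Fintype W] [LinearOrder V] {H : SimpleGraph W}
  {G G₁ G' : SimpleGraph V} {p r : ℕ} {δ : ℝ}
  {M : Finset (CopyType V W)} {B : CopyType V W → Finset V}

/-- In a maximal pruning, a branch that contains no vertex before its root can be exchanged
robustly. -/
theorem exists_rerouting (hadm : orderedAdm G r ≤ p) (hW : Fintype.card W ≤ r) (hp : 1 ≤ p)
    (hδ : 0 < δ) (hle : G' ≤ G)
    (hP : Pruning H G₁ (fun v => ((G.neighborSet v).ncard : ℝ)) (p * r) r δ G' M B)
    (hmax : ∀ x ∉ M, x.Eligible M B → x.fixed.length ≤ r →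
      δ < (G.neighborSet x.root).ncard → H.Adj x.k x.h →
      x.Robust H G' (p * r) ((G.neighborSet x.root).ncard / δ))
    {ψ : W → V} (hψ : IsCopy H G' ψ) {k h : W} (hkh : H.Adj k h)
    (hheavy : δ < (G.neighborSet (ψ k)).ncard) (n : ℕ) :
    ∀ l : List (W × V), l.length + n = Fintype.card W → (h :: l.map Prod.fst).Nodup →
      (∀ q ∈ l, ψ q.1 = q.2) → (∀ low, (⟨ψ k, k, h, low, l⟩ : CopyType V W).Eligible M B) →
      ∃ (D : Set W) (A : Finset V), k ∈ D ∧ h ∉ D ∧ (∀ z ∈ branch H D h, ¬ ψ z < ψ k) ∧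
        A.Nonempty ∧ (∀ a ∈ A, G.Adj (ψ k) a) ∧
        ((G.neighborSet (ψ k)).ncard : ℝ) ≤ δ * A.card ∧
        ∀ a ∈ A, ∃ ψ', IsCopy H G' ψ' ∧ (∀ w ∉ branch H D h, ψ' w = ψ w) ∧ ψ' h = a := by
  classical
  induction n with
  | zero =>
    intro l hl hnd
    have h1 := hnd.length_le_card
    simp only [List.length_cons, List.length_map] at h1
    omega
  | succ n ih =>
    intro l hl hnd hcons hel
    set D : Set W := (⟨ψ k, k, h, true, l⟩ : CopyType V W).dom with hD
    have hhD : h ∉ D := by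
      rintro (h1 | h1)
      · exact hkh.ne h1.symm
      · exact (List.nodup_cons.1 hnd).1 h1
    have hkD : k ∈ D := Or.inl rfl
    -- The flag records the truth for `ψ`, so that `ψ` fits the type `x`; the domain `D` does not
    -- depend on the flag.
    set low : Bool := decide (∃ z ∈ branch H D h, ψ z < ψ k) with hlow
    set x : CopyType V W := ⟨ψ k, k, h, low, l⟩ with hx
    have hdom : x.dom = D := rfl
    have hfits : x.Fits H G' ψ := ⟨hψ, rfl, hcons, fun ht => of_decide_eq_true ht⟩
    by_cases hxM : x ∈ M
    -- A treated type forces a new vertex `w ≠ h` of the branch into `B x`, and `w` joins the list.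
    -- Listed vertices are distinct and different from `h`, so this ends before `n` reaches 0.
    · obtain ⟨h1, w, hw, hwB⟩ := hP.meets x hxM ψ hfits
      have hwh : h ≠ w := fun he => h1 (by rw [← he] at hwB; exact hwB)
      have hwD : w ∉ D := notMem_of_mem_branch hhD hw
      refine ih ((w, ψ w) :: l) (by simp only [List.length_cons]; omega) ?_ ?_ ?_
      · have h2 := List.nodup_cons.1 hnd
        rw [List.map_cons, List.nodup_cons, List.nodup_cons, List.mem_cons, not_or]
        exact ⟨⟨hwh, h2.1⟩, fun h3 => hwD (Or.inr h3), h2.2⟩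
      · intro q hq
        rcases List.mem_cons.1 hq with rfl | hq
        · rfl
        · exact hcons q hq
      · exact fun low' => Or.inr ⟨w, ψ w, l, low, rfl, hxM, hwB⟩
    · have hrob := hmax x hxM (hel low) (by change l.length ≤ r; omega) hheavy hkh
      have hnonneg : (0 : ℝ) ≤ (G.neighborSet x.root).ncard / δ := by positivity
      by_cases hlo : ∃ z ∈ branch H D h, ψ z < ψ k
      · exfalso
        -- Robustness against the hitting set `C` gives a copy whose branch avoids `C`, yet contains
        -- an admissible path from the root. The strict inequality in `Robust` ensures that a copy
        -- exists.
        obtain ⟨C, hC, hhit⟩ := exists_hitting_set hadm (ψ k)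
        have h1 := hnonneg.trans_lt (hrob C hC)
        obtain ⟨a, ψ', hψ', -, hav⟩ :=
          Set.nonempty_of_ncard_ne_zero (by exact_mod_cast h1.ne')
        obtain ⟨z, hz, hzlow⟩ := hψ'.2.2.2 (decide_eq_true hlo)
        have hk' : ψ' k = ψ k := hψ'.2.1
        obtain ⟨y, Q, hQ, htail⟩ := exists_admissible_path_of_low hW (hψ'.1.mono hle) hkh hz
          (by rw [hk']; exact hzlow)
        rw [← hk'] at hhit
        obtain ⟨c, hc, hcQ⟩ := hhit y Q hQ
        obtain ⟨w, hw, rfl⟩ := htail c hcQ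
        exact hav w hw hc
      -- Robustness is now applied to the image of everything outside the branch, so that the new
      -- branches do not collide with the rest of `ψ`.
      · set C : Finset V := (Finset.univ.filter fun w => w ∉ branch H D h).image ψ with hC
        have hCcard : C.card ≤ p * r := by
          refine Finset.card_image_le.trans ((Finset.card_le_univ _).trans (hW.trans ?_))
          exact Nat.le_mul_of_pos_left r hp
        have h1 := hrob C hCcard
        set A := {a | ∃ ψ', x.Fits H G' ψ' ∧ ψ' x.h = a ∧ ∀ w ∈ branch H x.dom x.h, ψ' w ∉ C}
          with hA
        have hAcard : (A.toFinset.card : ℝ) = A.ncard := by rw [Set.ncard_eq_toFinset_card']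
        refine ⟨D, A.toFinset, hkD, hhD, fun z hz hlt => hlo ⟨z, hz, hlt⟩, ?_, ?_, ?_, ?_⟩
        · rw [← Finset.card_pos]
          have := hnonneg.trans_lt h1
          rw [← hAcard] at this
          exact_mod_cast this
        · intro a ha
          obtain ⟨ψ', hψ', rfl, -⟩ := Set.mem_toFinset.1 ha
          have := hle (hψ'.1.2 _ _ hkh)
          rwa [show ψ' k = ψ k from hψ'.2.1] at this
        · rw [hAcard]
          have := h1.le
          rwa [div_le_iff₀ hδ, mul_comm] at this
        · intro a ha
          obtain ⟨ψ', hψ', rfl, hav⟩ := Set.mem_toFinset.1 ha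
          have hagree : ∀ w ∈ D, ψ w = ψ' w := by
            rintro w (hw | hw)
            · rw [show w = k from hw]
              exact hψ'.2.1.symm
            · obtain ⟨q, hq, rfl⟩ := List.mem_map.1 hw
              rw [hcons q hq, hψ'.2.2.1 q hq]
          obtain ⟨φ, hφ, hφ1, hφ2⟩ := hψ.swap (h := h) hψ'.1 hagree fun w hw z hz he =>
            hav w hw (by rw [he, hC]; exact Finset.mem_image_of_mem _ (by simpa using hz))
          exact ⟨φ, hφ, hφ2, hφ1 h mem_branch_self⟩

/-- A light boundary vertex of `F` can keep the copy itself, as one neighbour is already a `1 / δ`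
fraction. If all are heavy, the one whose image is last in the order gives a branch disjoint from
`F`. -/
theorem reroutable_of_maximal_pruning (hH : H.Connected) (hadm : orderedAdm G r ≤ p)
    (hW : Fintype.card W ≤ r) (hp : 1 ≤ p) (hδ : 0 < δ) (hle : G' ≤ G)
    (hP : Pruning H G₁ (fun v => ((G.neighborSet v).ncard : ℝ)) (p * r) r δ G' M B)
    (hmax : ∀ x ∉ M, x.Eligible M B → x.fixed.length ≤ r →
      δ < (G.neighborSet x.root).ncard → H.Adj x.k x.h →
      x.Robust H G' (p * r) ((G.neighborSet x.root).ncard / δ)) :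
    Reroutable H G G' δ := by
  classical
  intro ψ hψ F hF hF'
  by_cases hlight : ∃ k ∈ F, ∃ h ∉ F, H.Adj k h ∧ ((G.neighborSet (ψ k)).ncard : ℝ) ≤ δ
  · obtain ⟨k, hk, h, hh, hkh, hd⟩ := hlight
    refine ⟨k, hk, h, hh, {ψ h}, Finset.singleton_nonempty _, ?_, by simpa using hd, ?_⟩
    · intro a ha
      rw [Finset.mem_singleton.1 ha]
      exact hle (hψ.2 _ _ hkh)
    · intro a ha
      exact ⟨ψ, hψ, fun _ _ => rfl, (Finset.mem_singleton.1 ha).symm⟩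
  · push Not at hlight
    set E := F.filter fun k => ∃ h ∉ F, H.Adj k h with hE
    have hEne : E.Nonempty := by
      obtain ⟨k, hk, h, hh, hkh⟩ := exists_adj_of_connected hH hF hF'
      exact ⟨k, Finset.mem_filter.2 ⟨hk, h, hh, hkh⟩⟩
    obtain ⟨k, hkE, hkmax⟩ := E.exists_max_image ψ hEne
    obtain ⟨hk, h, hh, hkh⟩ := Finset.mem_filter.1 hkE
    obtain ⟨D, A, hkD, hhD, hhigh, hA, hAadj, hAcard, hA'⟩ :=
      exists_rerouting hadm hW hp hδ hle hP hmax hψ hkh (hlight k hk h hh hkh) (Fintype.card W) []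
        (by simp) (by simp) (by simp) (fun _ => Or.inl rfl)
    refine ⟨k, hk, h, hh, A, hA, hAadj, hAcard, fun a ha => ?_⟩
    obtain ⟨ψ', hψ', hagree, hψa⟩ := hA' a ha
    refine ⟨ψ', hψ', fun w hw => hagree w fun hwb => ?_, hψa⟩
    -- The first vertex `c` of `F` reached by the branch would be a boundary vertex, so its image is
    -- not after that of `k`; it is not before it either, so `c = k`, but `k ∈ D`.
    have hdisj : ∀ z ∈ branch H D h, z ∉ F := by
      intro z hz
      induction hz with
      | refl => exact hh
      | @tail b c hb hbc ih =>
        intro hc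
        have hcb : c ∈ branch H D h := mem_branch_of_adj hb hbc.1 hbc.2
        have h1 : ψ c ≤ ψ k := hkmax c (Finset.mem_filter.2 ⟨hc, b, ih, hbc.1.symm⟩)
        have h2 : ψ c = ψ k := le_antisymm h1 (not_lt.1 (hhigh c hcb))
        exact hbc.2 (hψ.1 h2 ▸ hkD)
    exact hdisj w hwb hw

/-- The edges whose later end has large degree. -/
theorem ncard_le_of_later_end (hr : 1 ≤ r) (hadm : orderedAdm G r ≤ p) (S : Finset V) :
    {e | e ∈ G.edgeSet ∧ ∃ y ∈ S, ∃ z, z < y ∧ e = s(y, z)}.ncard ≤ S.card * p := by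
  classical
  have hsub : {e | e ∈ G.edgeSet ∧ ∃ y ∈ S, ∃ z, z < y ∧ e = s(y, z)} ⊆
      ((S.biUnion fun y => {z | G.Adj y z ∧ z < y}.toFinset.image fun z => s(y, z) :
        Finset (Sym2 V)) : Set (Sym2 V)) := by
    rintro e ⟨he, y, hy, z, hz, rfl⟩
    simp only [Finset.coe_biUnion, Set.mem_iUnion, Finset.mem_coe, Finset.mem_image]
    exact ⟨y, hy, z, by simpa using ⟨he, hz⟩, rfl⟩
  refine (Set.ncard_le_ncard hsub (Set.toFinite _)).trans ?_
  rw [Set.ncard_coe_finset]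
  refine Finset.card_biUnion_le_card_mul _ _ _ fun y _ => Finset.card_image_le.trans ?_
  rw [← Set.ncard_eq_toFinset_card']
  exact ncard_smaller_neighbors_le hr hadm y

theorem ncard_edgeSet_le (hr : 1 ≤ r) (hadm : orderedAdm G r ≤ p) :
    G.edgeSet.ncard ≤ Fintype.card V * p := by
  classical
  refine (Set.ncard_le_ncard (fun e he => ?_) (Set.toFinite _)).trans
    (ncard_le_of_later_end hr hadm Finset.univ)
  induction e with
  | _ a b =>
    rcases lt_trichotomy a b with h | h | h
    · exact ⟨he, b, Finset.mem_univ _, a, h, Sym2.eq_swap⟩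
    · exact absurd h (G.ne_of_adj he)
    · exact ⟨he, a, Finset.mem_univ _, b, h, rfl⟩

theorem sum_degree_eq (G : SimpleGraph V) :
    ∑ v, ((G.neighborSet v).ncard : ℝ) = 2 * G.edgeSet.ncard := by
  classical
  have h := G.sum_degrees_eq_twice_card_edges
  have h1 : ∀ v, (G.neighborSet v).ncard = G.degree v := fun v => by
    rw [Set.ncard_eq_toFinset_card', SimpleGraph.degree, SimpleGraph.neighborFinset]
  have h2 : G.edgeSet.ncard = G.edgeFinset.card := by
    rw [Set.ncard_eq_toFinset_card', SimpleGraph.edgeFinset]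
  simp only [h1, h2]
  exact_mod_cast h

/-- Deleting few edges from an admissible graph makes all copies of `H` reroutable. -/
theorem exists_reroutable (hH : H.Connected) (hadm : orderedAdm G r ≤ p)
    (hW : Fintype.card W ≤ r) (hp : 1 ≤ p) (hr : 1 ≤ r) {α : ℝ} (hα : 0 < α) (hδ : 0 < δ) :
    ∃ G' ≤ G, Reroutable H G G' δ ∧
      (∀ x y, G'.Adj x y →
        ((G.neighborSet x).ncard : ℝ) ≤ α ∨ ((G.neighborSet y).ncard : ℝ) ≤ α) ∧
      ((G.edgeSet \ G'.edgeSet).ncard : ℝ) ≤ (2 * p ^ 2 / α +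
        typeBound (Fintype.card W) (p * r) r * (1 + p * r) * (2 * p) / δ) * Fintype.card V := by
  classical
  set d : V → ℝ := fun v => ((G.neighborSet v).ncard : ℝ) with hd
  set S : Finset V := Finset.univ.filter fun v => α < d v with hS
  -- At most `2 * p * n / α` vertices have degree above `α`, and each has at most `p` earlier
  -- neighbours. After deleting `Z`, every edge has a light later end.
  set Z : Set (Sym2 V) := {e | e ∈ G.edgeSet ∧ ∃ y ∈ S, ∃ z, z < y ∧ e = s(y, z)} with hZ
  set G₁ := G.deleteEdges Z with hG₁
  -- The pruning starts from `G₁`, but its weights are degrees in `G`, because the oracle draws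
  -- neighbours in `G`.
  obtain ⟨G', M, B, hP, hmax⟩ := exists_maximal_pruning H G₁ d (p * r) r hδ
  have hle : G' ≤ G := hP.le.trans (SimpleGraph.deleteEdges_le _)
  have hsum : ∑ v, d v ≤ 2 * p * Fintype.card V := by
    rw [hd, sum_degree_eq]
    have : (G.edgeSet.ncard : ℝ) ≤ Fintype.card V * p := by
      exact_mod_cast ncard_edgeSet_le hr hadm
    linarith
  refine ⟨G', hle, reroutable_of_maximal_pruning hH hadm hW hp hδ hle hP hmax, ?_, ?_⟩
  · intro x y hxy
    by_contra! hno
    have h1 := hP.le hxy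
    rw [hG₁, SimpleGraph.deleteEdges_adj] at h1
    rcases lt_trichotomy x y with h | h | h
    · exact h1.2 ⟨h1.1, y, by simpa [hS] using hno.2, x, h, Sym2.eq_swap⟩
    · exact G'.ne_of_adj hxy h
    · exact h1.2 ⟨h1.1, x, by simpa [hS] using hno.1, y, h, rfl⟩
  · have h1 : G.edgeSet \ G'.edgeSet ⊆ Z ∪ (G₁.edgeSet \ G'.edgeSet) := by
      rintro e ⟨he, hne⟩
      by_cases hz : e ∈ Z
      · exact Or.inl hz
      · refine Or.inr ⟨?_, hne⟩
        rw [hG₁, SimpleGraph.edgeSet_deleteEdges]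
        exact ⟨he, hz⟩
    have h2 : ((G.edgeSet \ G'.edgeSet).ncard : ℝ) ≤ Z.ncard + (G₁.edgeSet \ G'.edgeSet).ncard := by
      exact_mod_cast (Set.ncard_le_ncard h1 (Set.toFinite _)).trans (Set.ncard_union_le _ _)
    have h3 : (Z.ncard : ℝ) ≤ S.card * p := by
      exact_mod_cast ncard_le_of_later_end hr hadm S
    have h4 : S.card * α ≤ 2 * p * Fintype.card V := by
      refine le_trans ?_ hsum
      rw [← nsmul_eq_mul, ← Finset.sum_const]
      refine (Finset.sum_le_sum fun v hv => ?_).trans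
        (Finset.sum_le_sum_of_subset_of_nonneg (Finset.subset_univ S) fun v _ _ => by positivity)
      exact (Finset.mem_filter.1 hv).2.le
    have h5 : (S.card : ℝ) * p ≤ 2 * p ^ 2 / α * Fintype.card V := by
      rw [div_mul_eq_mul_div, le_div_iff₀ hα]
      have := mul_le_mul_of_nonneg_right h4 (Nat.cast_nonneg (α := ℝ) p)
      linarith
    have h6 := hP.cost_le hδ (fun v => by positivity)
    have h7 : typeBound (Fintype.card W) (p * r) r * (1 + ((p * r : ℕ) : ℝ)) * (∑ v, d v) / δ ≤
        typeBound (Fintype.card W) (p * r) r * (1 + p * r) * (2 * p) / δ * Fintype.card V := by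
      rw [div_mul_eq_mul_div]
      push_cast
      rw [mul_assoc _ (2 * (p : ℝ))]
      gcongr
    linarith

end

open OracleAlg
open scoped ENNReal

/-! ### The exploration finds copies -/

/-- The explored part contains at least `i` vertices and edges of a copy of `H` in `G'`, or a
complete copy. -/
def Progress {V : Type} {W : Type*} (H : SimpleGraph W) (G' : SimpleGraph V) (i : ℕ)
    (S : Explored V) : Prop :=
  ∃ ψ : W → V, IsCopy H G' ψ ∧ ∃ (F : Finset W) (D : Finset (W × W)), F.Nonempty ∧
    (∀ w ∈ F, ψ w ∈ S.verts) ∧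
    (∀ q ∈ D, q.1 ∈ F ∧ q.2 ∈ F ∧ s(ψ q.1, ψ q.2) ∈ S.edges) ∧
    (i ≤ F.card + D.card ∨ ((∀ w, w ∈ F) ∧ ∀ x y, H.Adj x y → (x, y) ∈ D))

section

variable {V : Type} {W : Type*} [Fintype W] {H : SimpleGraph W} {G G' : SimpleGraph V} {δ : ℝ}

theorem Progress.isContained {i : ℕ} {S : Explored V} (h : Progress H G' i S)
    (hi : Fintype.card W + Fintype.card W ^ 2 < i) : H.IsContained S.graph := by
  obtain ⟨ψ, hψ, F, D, -, hF, hD, h | ⟨h1, h2⟩⟩ := h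
  · have h1 := Finset.card_le_univ F
    have h2 := Finset.card_le_univ D
    rw [Fintype.card_prod, ← pow_two] at h2
    omega
  · refine ⟨⟨⟨fun w => ⟨ψ w, hF w (h1 w)⟩, fun {a b} hab => ?_⟩, fun a b hab => ?_⟩⟩
    · simp only [Explored.graph, SimpleGraph.comap_adj, SimpleGraph.fromEdgeSet_adj]
      exact ⟨(hD _ (h2 a b hab)).2.2, fun he => hab.ne (hψ.1 he)⟩
    · exact hψ.1 (congrArg Subtype.val hab)

variable [Fintype V] [DecidableEq V] [Nonempty V]

/-- While vertices are missing, rerouting gives a `1 / δ` chance per query. The new copy agrees with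
the old one on `F`, so the pairs in `D` stay valid. When only edges are missing, a missing edge is
one of at most `δ` edges at its light end. -/
theorem failProb_progress_le (hre : Reroutable H G G' δ) (hle : G' ≤ G) (hδ : 0 < δ)
    (hlight : ∀ x y, G'.Adj x y →
      ((G.neighborSet x).ncard : ℝ) ≤ δ ∨ ((G.neighborSet y).ncard : ℝ) ≤ δ)
    (m i : ℕ) (S : Explored V) (hS : Progress H G' i S) :
    failProb (run G (middleLoop m S)) (Progress H G' (i + 1)) ≤
      ENNReal.ofReal (1 - 1 / δ) ^ m := by
  classical
  obtain ⟨ψ, hψ, F, D, hFne, hF, hD, hi⟩ := hS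
  by_cases hfull : (∀ w, w ∈ F) ∧ ∀ x y, H.Adj x y → (x, y) ∈ D
  · rw [failProb_run_of_allOutputs G
      ((allOutputs_middleLoop (P := fun T => S.Sub T) (fun T U h h' => h'.trans h) m S
        ⟨subset_rfl, subset_rfl⟩).mono fun T hT => ?_)]
    · exact bot_le
    · exact ⟨ψ, hψ, F, D, hFne, fun w hw => hT.1 (hF w hw),
        fun q hq => ⟨(hD q hq).1, (hD q hq).2.1, hT.2 (hD q hq).2.2⟩, Or.inr hfull⟩
  have hi : i ≤ F.card + D.card := hi.resolve_right hfull
  by_cases hFu : ∀ w, w ∈ F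
  · have : ∃ x y, H.Adj x y ∧ (x, y) ∉ D := by
      by_contra! hno
      exact hfull ⟨hFu, hno⟩
    obtain ⟨x, y, hxy, hxyD⟩ := this
    have hstep : ∀ T : Explored V, S.Sub T → s(ψ x, ψ y) ∈ T.edges → Progress H G' (i + 1) T := by
      intro T hT he
      refine ⟨ψ, hψ, F, insert (x, y) D, hFne, fun w hw => hT.1 (hF w hw), fun q hq => ?_,
        Or.inl (by rw [Finset.card_insert_of_notMem hxyD]; omega)⟩
      rcases Finset.mem_insert.1 hq with rfl | hq
      · exact ⟨hFu _, hFu _, he⟩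
      · exact ⟨(hD q hq).1, (hD q hq).2.1, hT.2 (hD q hq).2.2⟩
    have hc : ∀ u v : V, ((G.neighborSet u).ncard : ℝ) ≤ δ →
        1 / δ * ((G.neighborSet u).ncard : ℝ) ≤ (({v} : Finset V).card : ℝ) := by
      intro u v h
      rw [one_div, Finset.card_singleton, Nat.cast_one, inv_mul_le_iff₀ hδ, mul_one]
      exact h
    have hadj := hle (hψ.2 x y hxy)
    rcases hlight _ _ (hψ.2 x y hxy) with hl | hl
    · refine (failProb_mono ?_).trans (failProb_middleLoop_le G (hF x (hFu x)) (A := {ψ y})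
        (by simpa using hadj) (Finset.singleton_nonempty _) (hc _ _ hl))
      rintro T ⟨hT, a, ha, -, he⟩
      rw [Finset.mem_singleton.1 ha] at he
      exact hstep T hT he
    · refine (failProb_mono ?_).trans (failProb_middleLoop_le G (hF y (hFu y)) (A := {ψ x})
        (by simpa using hadj.symm) (Finset.singleton_nonempty _) (hc _ _ hl))
      rintro T ⟨hT, a, ha, -, he⟩
      rw [Finset.mem_singleton.1 ha, Sym2.eq_swap] at he
      exact hstep T hT he
  · obtain ⟨k, hk, h, hh, A, hA, hAadj, hAcard, hA'⟩ := hre ψ hψ F hFne (not_forall.1 hFu)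
    refine (failProb_mono ?_).trans (failProb_middleLoop_le G (hF k hk) hAadj hA
      (by rw [one_div, inv_mul_le_iff₀ hδ]; exact hAcard))
    rintro T ⟨hT, a, ha, haT, -⟩
    obtain ⟨ψ', hψ', hagree, rfl⟩ := hA' a ha
    refine ⟨ψ', hψ', insert h F, D, Finset.insert_nonempty _ _, fun w hw => ?_, fun q hq => ?_,
      Or.inl (by rw [Finset.card_insert_of_notMem hh]; omega)⟩
    · rcases Finset.mem_insert.1 hw with rfl | hw
      · exact haT
      · rw [hagree w hw]; exact hT.1 (hF w hw)
    · obtain ⟨h1, h2, h3⟩ := hD q hq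
      refine ⟨Finset.mem_insert_of_mem h1, Finset.mem_insert_of_mem h2, ?_⟩
      rw [hagree _ h1, hagree _ h2]
      exact hT.2 h3

/-- A sampled vertex in `A` is progress 1. After `m₂` successful rounds progress exceeds the number
of vertices and ordered pairs of `W`, so the copy is complete. -/
theorem failProb_explore_le (hre : Reroutable H G G' δ) (hle : G' ≤ G) (hδ : 0 < δ)
    (hlight : ∀ x y, G'.Adj x y →
      ((G.neighborSet x).ncard : ℝ) ≤ δ ∨ ((G.neighborSet y).ncard : ℝ) ≤ δ)
    {A : Finset V} (hA : ∀ a ∈ A, ∃ ψ : W → V, IsCopy H G' ψ ∧ a ∈ Set.range ψ) {c : ℝ}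
    (hc : c * Fintype.card V ≤ A.card) {m₁ m₂ m₃ : ℕ}
    (hm : Fintype.card W + Fintype.card W ^ 2 ≤ m₂) :
    failProb (run G (explore m₁ m₂ m₃)) (fun S => H.IsContained S.graph) ≤
      ENNReal.ofReal (1 - c) ^ m₁ + m₂ * ENNReal.ofReal (1 - 1 / δ) ^ m₃ := by
  rw [explore, run_bind]
  have hinit := failProb_initialSample_le G m₁ hc
  refine (failProb_bind_le (P := fun S => ∃ a ∈ A, a ∈ S.verts)
    (e := m₂ * ENNReal.ofReal (1 - 1 / δ) ^ m₃) fun S hS => ?_).trans (add_le_add hinit le_rfl)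
  obtain ⟨a, ha, haS⟩ := hS
  obtain ⟨ψ, hψ, w, rfl⟩ := hA a ha
  have hS1 : Progress H G' 1 S :=
    ⟨ψ, hψ, {w}, ∅, Finset.singleton_nonempty _, by simpa using haS, by simp, Or.inl (by simp)⟩
  have hrounds := failProb_repeatTimes_le G (step := middleLoop m₃) (I := Progress H G')
    (e := ENNReal.ofReal (1 - 1 / δ) ^ m₃)
    (fun i T hT => failProb_progress_le hre hle hδ hlight m₃ i T hT) m₂ 1 S hS1
  have hlt : Fintype.card W + Fintype.card W ^ 2 < 1 + m₂ := by omega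
  exact (failProb_mono fun T hT => Progress.isContained hT hlt).trans hrounds

end

/-! ### Parameters -/

section Parameters

theorem ofReal_one_sub_pow_le {c t : ℝ} {m : ℕ} (h : t ≤ c * m) :
    ENNReal.ofReal (1 - c) ^ m ≤ ENNReal.ofReal (Real.exp (-t)) := by
  calc ENNReal.ofReal (1 - c) ^ m ≤ ENNReal.ofReal (Real.exp (-c)) ^ m := by
        gcongr
        exact Real.one_sub_le_exp_neg c
    _ = ENNReal.ofReal (Real.exp (-(c * m))) := by
        rw [← ENNReal.ofReal_pow (Real.exp_pos _).le, ← Real.exp_nat_mul]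
        congr 2; ring
    _ ≤ _ := by gcongr

theorem exp_neg_le {t : ℝ} (ht : 0 < t) : Real.exp (-t) ≤ 2 / t ^ 2 := by
  have h := Real.quadratic_le_exp_of_nonneg ht.le
  rw [Real.exp_neg, ← one_div, div_le_div_iff₀ (Real.exp_pos _) (by positivity)]
  nlinarith

variable {p r : ℕ} {ε : ℝ}

theorem alpha_pos (hp : 1 ≤ p) (hε : 0 < ε) : 0 < alpha p ε := by
  have : (0 : ℝ) < p := by exact_mod_cast hp
  unfold alpha; positivity

theorem delta_pos (hp : 1 ≤ p) (hr : 1 ≤ r) (hε : 0 < ε) : 0 < delta p r ε := by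
  have : (0 : ℝ) < p := by exact_mod_cast hp
  have : (0 : ℝ) < r := by exact_mod_cast hr
  have : 0 < beta p r ε := by unfold beta; positivity
  unfold delta; positivity

/-- With `20 * r * δ` attempts of success probability `1 / δ`, a round fails with probability at
most `exp (-20 * r)`; the bound `2 / t ^ 2` for `exp (-t)` already beats the quadratic number of
rounds. -/
theorem rounds_failure_le (hr : 1 ≤ r) (hδ : 0 < delta p r ε) :
    (xi₂ r : ℝ≥0∞) * ENNReal.ofReal (1 - 1 / delta p r ε) ^ xi₃ p r ε ≤ ENNReal.ofReal (1 / 20) := by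
  have hr' : (1 : ℝ) ≤ r := by exact_mod_cast hr
  have h1 : (20 : ℝ) * r ≤ 1 / delta p r ε * xi₃ p r ε := by
    rw [one_div, ← div_eq_inv_mul, le_div_iff₀ hδ]
    exact Nat.le_ceil _
  refine (mul_le_mul_right (ofReal_one_sub_pow_le h1) _).trans ?_
  rw [← ENNReal.ofReal_natCast, ← ENNReal.ofReal_mul (by positivity)]
  refine ENNReal.ofReal_le_ofReal ?_
  have h2 := exp_neg_le (t := 20 * r) (by positivity)
  have h3 : (xi₂ r : ℝ) ≤ 5 * r ^ 2 := by
    unfold xi₂; push_cast; nlinarith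
  calc (xi₂ r : ℝ) * Real.exp (-(20 * r)) ≤ 5 * r ^ 2 * (2 / (20 * r) ^ 2) := by gcongr
    _ = 1 / 40 := by field_simp; norm_num
    _ ≤ 1 / 20 := by norm_num

/-- With `L = logb 2 r ≥ 1`, both `p` and `r` are at most `p ^ L`. This is the origin of the
exponent in `beta`. -/
theorem pow_le_rpow (hp : 2 ≤ p) (hr : 2 ≤ r) :
    ((p * r : ℕ) : ℝ) ^ (8 * r ^ 2) ≤ (p : ℝ) ^ (16 * (r : ℝ) ^ 2 * Real.logb 2 r) := by
  have hp1 : (1 : ℝ) ≤ p := by exact_mod_cast (by omega : 1 ≤ p)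
  have hp0 : (0 : ℝ) < p := by linarith
  have hr0 : (0 : ℝ) < r := by exact_mod_cast (by omega : 0 < r)
  set L := Real.logb 2 r with hL
  have hL1 : 1 ≤ L := by
    rw [hL, Real.le_logb_iff_rpow_le (by norm_num) hr0, Real.rpow_one]
    exact_mod_cast hr
  have hrL : (r : ℝ) ≤ (p : ℝ) ^ L := by
    calc (r : ℝ) = 2 ^ L := (Real.rpow_logb (by norm_num) (by norm_num) hr0).symm
      _ ≤ (p : ℝ) ^ L := by
        refine Real.rpow_le_rpow (by norm_num) (by exact_mod_cast hp) (by linarith)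
  have hpL : (p : ℝ) ≤ (p : ℝ) ^ L := by
    calc (p : ℝ) = (p : ℝ) ^ (1 : ℝ) := (Real.rpow_one _).symm
      _ ≤ _ := Real.rpow_le_rpow_of_exponent_le hp1 hL1
  calc ((p * r : ℕ) : ℝ) ^ (8 * r ^ 2) ≤ ((p : ℝ) ^ L * (p : ℝ) ^ L) ^ (8 * r ^ 2) := by
        push_cast; gcongr
    _ = _ := by
        rw [← Real.rpow_add hp0, ← Real.rpow_natCast, ← Real.rpow_mul hp0.le]
        congr 1; push_cast; ring

theorem typeBound_mono {w w' : ℕ} (h : w ≤ w') (b r : ℕ) : typeBound w b r ≤ typeBound w' b r := by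
  unfold typeBound
  gcongr

theorem typeBound_le (hp : 2 ≤ p) (hr : 2 ≤ r) :
    typeBound r (p * r) r * (1 + p * r) * (2 * p) ≤ (p * r) ^ (2 * r + 7) := by
  set Q := p * r with hQ
  have hQ2 : 2 * r ≤ Q := Nat.mul_le_mul_right r hp
  have hQp : 2 * p ≤ Q := by rw [hQ, mul_comm]; exact Nat.mul_le_mul_left p hr
  have hsum : ∑ j ∈ Finset.range (r + 1), (2 * r * Q) ^ j ≤ Q * (Q ^ 2) ^ r := by
    refine (Finset.sum_le_card_nsmul _ _ ((Q ^ 2) ^ r) fun j hj => ?_).trans ?_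
    · have hj' : j ≤ r := Nat.lt_succ_iff.1 (Finset.mem_range.1 hj)
      refine (Nat.pow_le_pow_left (m := Q ^ 2) ?_ j).trans
        (Nat.pow_le_pow_right (by positivity) hj')
      rw [pow_two]; exact Nat.mul_le_mul_right _ hQ2
    · rw [Finset.card_range, smul_eq_mul]
      exact Nat.mul_le_mul_right _ (by omega)
  have h1 : 2 * r ^ 2 ≤ Q ^ 2 := by nlinarith
  have h2 : 1 + Q ≤ Q ^ 2 := by nlinarith
  have h3 : 2 * p ≤ Q ^ 2 := by nlinarith
  calc typeBound r Q r * (1 + Q) * (2 * p) ≤ (Q ^ 2 * (Q * (Q ^ 2) ^ r)) * Q ^ 2 * Q ^ 2 := by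
        unfold typeBound; gcongr
    _ = Q ^ (2 * r + 7) := by rw [← pow_mul]; ring

/-- The right-hand side equals `2 ^ 23 * r * X ^ 3 / ε ^ 2`. The factor `ε ^ 2` is absorbed by two
powers of `p * r`, since `ε ≤ p ≤ p * r`; hence `m + 2`. -/
theorem pow_le_mul_delta (hp : 2 ≤ p) (hr : 2 ≤ r) (hε : 0 < ε) (hεp : ε ≤ p) {m : ℕ}
    (hm : m + 2 ≤ 8 * r ^ 2) :
    8 * ((p * r : ℕ) : ℝ) ^ m ≤ ε / 2 * delta p r ε := by
  set X := (p : ℝ) ^ (16 * (r : ℝ) ^ 2 * Real.logb 2 r) with hX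
  have hp0 : (0 : ℝ) < p := by exact_mod_cast (by omega : 0 < p)
  have hr1 : (1 : ℝ) ≤ r := by exact_mod_cast (by omega : 1 ≤ r)
  have hQ1 : (1 : ℝ) ≤ ((p * r : ℕ) : ℝ) := by
    exact_mod_cast Nat.one_le_iff_ne_zero.2 (Nat.mul_ne_zero (by omega) (by omega))
  have hpQ : (p : ℝ) ≤ ((p * r : ℕ) : ℝ) := by push_cast; nlinarith
  have hXQ : ((p * r : ℕ) : ℝ) ^ (m + 2) ≤ X :=
    (pow_le_pow_right₀ hQ1 hm).trans (pow_le_rpow hp hr)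
  have hX1 : 1 ≤ X := (one_le_pow₀ hQ1).trans hXQ
  have hX3 : X ≤ X ^ 3 := le_self_pow₀ hX1 (by norm_num)
  have h1 : ε ^ 2 * ((p * r : ℕ) : ℝ) ^ m ≤ X ^ 3 := by
    refine le_trans ?_ (hXQ.trans hX3)
    rw [pow_add, mul_comm]
    gcongr
    exact hεp.trans hpQ
  have h2 : ε / 2 * delta p r ε = 2 ^ 23 * r * X ^ 3 / ε ^ 2 := by
    unfold delta beta
    rw [← hX]
    field_simp
    ring
  rw [h2, le_div_iff₀ (by positivity)]
  have h3 : X ^ 3 ≤ r * X ^ 3 := le_mul_of_one_le_left (by positivity) hr1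
  linarith [pow_pos (hp0) 2]

theorem alpha_le_delta (hp : 2 ≤ p) (hr : 2 ≤ r) (hε : 0 < ε) (hεp : ε ≤ p) :
    alpha p ε ≤ delta p r ε := by
  have h := pow_le_mul_delta hp hr hε hεp (m := 2) (by nlinarith)
  have hpQ : (p : ℝ) ≤ ((p * r : ℕ) : ℝ) := by
    exact_mod_cast Nat.le_mul_of_pos_right p (by omega)
  unfold alpha
  rw [div_le_iff₀ (by positivity), mul_comm (delta p r ε)]
  refine le_trans ?_ h
  gcongr

theorem type_cost_le (hp : 2 ≤ p) (hr : 2 ≤ r) (hε : 0 < ε) (hεp : ε ≤ p) {w : ℕ} (hw : w ≤ r) :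
    (typeBound w (p * r) r : ℝ) * (1 + p * r) * (2 * p) / delta p r ε ≤ 3 / 4 * (ε / 2) := by
  have h := pow_le_mul_delta hp hr hε hεp (m := 2 * r + 7) (by nlinarith)
  have hδ := delta_pos (p := p) (r := r) (by omega) (by omega) hε
  have h1 : ((typeBound w (p * r) r * (1 + p * r) * (2 * p) : ℕ) : ℝ) ≤
      ((p * r : ℕ) : ℝ) ^ (2 * r + 7) := by
    rw [← Nat.cast_pow]
    refine Nat.cast_le.2 (le_trans ?_ (typeBound_le hp hr))
    have := typeBound_mono hw (p * r) r
    gcongr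
  push_cast at h1 h
  rw [div_le_iff₀ hδ]
  have h0 : 0 ≤ ((p : ℝ) * r) ^ (2 * r + 7) := by positivity
  linarith

end Parameters

/-! ### Admissible graphs that are far from `H`-freeness -/

section Far

/-- A minimizing order need not be exhibited: in `ℕ∞`, a value below `p + 1` is at most `p`. -/
theorem exists_order_of_isAdmissible {V : Type*} {G : SimpleGraph V} {p r : ℕ}
    (h : IsAdmissible p r G) : ∃ o : LinearOrder V, @orderedAdm V o G r ≤ p := by
  have h1 : adm G r < (p : ℕ∞) + 1 := by
    refine lt_of_le_of_lt h ?_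
    exact_mod_cast Nat.lt_succ_self p
  obtain ⟨o, ho⟩ := iInf_lt_iff.1 h1
  exact ⟨o, by rwa [ENat.lt_add_one_iff (by simp)] at ho⟩

theorem ncard_edges_diff_le_of_isFar {V : Type*} [Fintype V] {W : Type*} {H : SimpleGraph W}
    {G G' : SimpleGraph V} {ε : ℝ} (hfar : IsFar ε H.Free G) (hle : G' ≤ G) (hfree : H.Free G') :
    ε * Fintype.card V ≤ ((G.edgeSet \ G'.edgeSet).ncard : ℝ) := by
  have h := hfar G' hfree
  rwa [show symmDiff G.edgeSet G'.edgeSet = G.edgeSet \ G'.edgeSet from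
    symmDiff_of_ge (SimpleGraph.edgeSet_subset_edgeSet.2 hle)] at h

theorem exists_adj_of_nontrivial {W : Type*} [Nontrivial W] {H : SimpleGraph W}
    (hH : H.Connected) : ∃ x y, H.Adj x y := by
  obtain ⟨a, b, hab⟩ := exists_pair_ne W
  obtain ⟨k, -, h, -, hkh⟩ := exists_adj_of_connected hH (F := {a}) (Finset.singleton_nonempty a)
    ⟨b, by simpa using hab.symm⟩
  exact ⟨k, h, hkh⟩

/-- If `G` is far from `H`-freeness, then after the deletion of few edges, many vertices of small
degree lie on copies of `H`. -/
theorem exists_many_on_copies {V : Type*} [Fintype V] {W : Type*} [Nontrivial W]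
    {H : SimpleGraph W} (hH : H.Connected) {G G' : SimpleGraph V} (hle : G' ≤ G) {ε α : ℝ}
    (hfar : IsFar ε H.Free G) (hα : 0 < α)
    (hlight : ∀ x y, G'.Adj x y →
      ((G.neighborSet x).ncard : ℝ) ≤ α ∨ ((G.neighborSet y).ncard : ℝ) ≤ α)
    (hcost : ((G.edgeSet \ G'.edgeSet).ncard : ℝ) ≤ ε / 2 * Fintype.card V) :
    ∃ A : Finset V, (∀ a ∈ A, ∃ ψ : W → V, IsCopy H G' ψ ∧ a ∈ Set.range ψ) ∧
      ε / 2 / α * Fintype.card V ≤ A.card := by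
  classical
  set A : Finset V := Finset.univ.filter fun a =>
    ((G.neighborSet a).ncard : ℝ) ≤ α ∧ ∃ ψ : W → V, IsCopy H G' ψ ∧ a ∈ Set.range ψ with hA
  refine ⟨A, fun a ha => (Finset.mem_filter.1 ha).2.2, ?_⟩
  set Z : Set (Sym2 V) := {e | ∃ a ∈ A, ∃ z, G.Adj a z ∧ e = s(a, z)} with hZ
  set G'' := G'.deleteEdges Z with hG''
  have hle' : G'' ≤ G' := SimpleGraph.deleteEdges_le _
  -- Any copy in `G''` has an edge, one end of which is light and hence in `A`; but the edges at `A`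
  -- are gone.
  have hfree : H.Free G'' := by
    intro hcont
    obtain ⟨ψ, hψ⟩ := exists_isCopy hcont
    obtain ⟨x, y, hxy⟩ := exists_adj_of_nontrivial hH
    have h1 := hψ.2 x y hxy
    rw [hG'', SimpleGraph.deleteEdges_adj] at h1
    have hmem : ∀ w, ((G.neighborSet (ψ w)).ncard : ℝ) ≤ α → ψ w ∈ A := fun w hw =>
      Finset.mem_filter.2 ⟨Finset.mem_univ _, hw, ψ, hψ.mono hle', w, rfl⟩
    rcases hlight _ _ h1.1 with h | h
    · exact h1.2 ⟨ψ x, hmem x h, ψ y, hle h1.1, rfl⟩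
    · exact h1.2 ⟨ψ y, hmem y h, ψ x, hle h1.1.symm, Sym2.eq_swap⟩
  have h1 := ncard_edges_diff_le_of_isFar hfar (hle'.trans hle) hfree
  have hZcard : (Z.ncard : ℝ) ≤ A.card * α := by
    have hsub : Z ⊆ ((A.biUnion fun a => (G.neighborSet a).toFinset.image fun z => s(a, z) :
        Finset (Sym2 V)) : Set (Sym2 V)) := by
      rintro e ⟨a, ha, z, hz, rfl⟩
      simp only [Finset.coe_biUnion, Set.mem_iUnion, Finset.mem_coe, Finset.mem_image]
      exact ⟨a, ha, z, by simpa using hz, rfl⟩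
    have h2 := Set.ncard_le_ncard hsub (Set.toFinite _)
    rw [Set.ncard_coe_finset] at h2
    have h3 : ((A.biUnion fun a => (G.neighborSet a).toFinset.image fun z => s(a, z)).card : ℝ) ≤
        ∑ a ∈ A, ((G.neighborSet a).ncard : ℝ) := by
      refine le_trans (Nat.cast_le.2 Finset.card_biUnion_le) ?_
      push_cast
      refine Finset.sum_le_sum fun a _ => Nat.cast_le.2 (Finset.card_image_le.trans ?_)
      rw [Set.ncard_eq_toFinset_card']
    calc (Z.ncard : ℝ) ≤ _ := Nat.cast_le.2 h2
      _ ≤ _ := h3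
      _ ≤ ∑ a ∈ A, α := Finset.sum_le_sum fun a ha => (Finset.mem_filter.1 ha).2.1
      _ = A.card * α := by rw [Finset.sum_const, nsmul_eq_mul]
  have hsub : G.edgeSet \ G''.edgeSet ⊆ (G.edgeSet \ G'.edgeSet) ∪ Z := by
    rintro e ⟨he, hne⟩
    by_cases hz : e ∈ Z
    · exact Or.inr hz
    · refine Or.inl ⟨he, fun h => hne ?_⟩
      rw [hG'', SimpleGraph.edgeSet_deleteEdges]
      exact ⟨h, hz⟩
  have h2 : ((G.edgeSet \ G''.edgeSet).ncard : ℝ) ≤ (G.edgeSet \ G'.edgeSet).ncard + Z.ncard := by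
    exact_mod_cast (Set.ncard_le_ncard hsub (Set.toFinite _)).trans (Set.ncard_union_le _ _)
  rw [div_mul_eq_mul_div, div_le_iff₀ hα]
  linarith

theorem failProb_explore_le_of_isFar {V : Type} [Fintype V] [DecidableEq V] [Nonempty V]
    {W : Type*} [Fintype W] {H : SimpleGraph W} (hH : H.Connected) {p r : ℕ} (hp : 2 ≤ p)
    (hW : Fintype.card W ≤ r) {ε : ℝ} (hε : 0 < ε) {G : SimpleGraph V}
    (hadm : IsAdmissible p r G) (hfar : IsFar ε H.Free G) :
    failProb (run G (explore (xi₁ p ε) (xi₂ r) (xi₃ p r ε))) (fun S => H.IsContained S.graph) ≤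
      1 / 3 := by
  classical
  have := hH.nonempty
  have hr1 : 1 ≤ r := Fintype.card_pos.trans_le hW
  have hδ : 0 < delta p r ε := delta_pos (by omega) hr1 hε
  have hα : 0 < alpha p ε := alpha_pos (by omega) hε
  have hm : Fintype.card W + Fintype.card W ^ 2 ≤ xi₂ r := by
    have := Nat.pow_le_pow_left hW 2
    unfold xi₂
    omega
  have hxi₁ : 20 * alpha p ε / (ε / 2) ≤ xi₁ p ε := Nat.le_ceil _
  suffices h : ∃ (G' : SimpleGraph V) (A : Finset V) (c : ℝ), Reroutable H G G' (delta p r ε) ∧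
      G' ≤ G ∧ (∀ x y, G'.Adj x y → ((G.neighborSet x).ncard : ℝ) ≤ delta p r ε ∨
        ((G.neighborSet y).ncard : ℝ) ≤ delta p r ε) ∧
      (∀ a ∈ A, ∃ ψ : W → V, IsCopy H G' ψ ∧ a ∈ Set.range ψ) ∧ c * Fintype.card V ≤ A.card ∧
      ENNReal.ofReal (1 - c) ^ xi₁ p ε ≤ ENNReal.ofReal (1 / 20) by
    obtain ⟨G', A, c, hre, hle, hlight, hA, hc, hstart⟩ := h
    refine (failProb_explore_le hre hle hδ hlight hA hc hm).trans
      ((add_le_add hstart (rounds_failure_le hr1 hδ)).trans ?_)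
    rw [← ENNReal.ofReal_add (by norm_num) (by norm_num)]
    calc ENNReal.ofReal (1 / 20 + 1 / 20) ≤ ENNReal.ofReal (1 / 3) := by gcongr; norm_num
      _ = 1 / 3 := by rw [ENNReal.ofReal_div_of_pos (by norm_num)]; simp
  rcases subsingleton_or_nontrivial W with hsub | hnt
  -- For a one-vertex `H` every vertex is a copy and there is no proper nonempty part to extend, so
  -- one sampled vertex suffices. This case is separate because the parameter estimates need `2 ≤
  -- r`.
  · refine ⟨⊥, Finset.univ, 1, ?_, bot_le, fun x y h => absurd h (by simp), ?_, by simp, ?_⟩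
    · rintro ψ - F ⟨w, hw⟩ ⟨z, hz⟩
      exact absurd (Subsingleton.elim w z ▸ hw) hz
    · intro a _
      exact ⟨fun _ => a, ⟨fun x y _ => Subsingleton.elim x y,
        fun x y h => absurd (Subsingleton.elim x y) h.ne⟩, Classical.arbitrary W, rfl⟩
    · have h0 : xi₁ p ε ≠ 0 := by
        have : 0 < 20 * alpha p ε / (ε / 2) := by positivity
        exact (Nat.ceil_pos.2 this).ne'
      simp [h0]
  · have hr : 2 ≤ r := (Fintype.one_lt_card (α := W)).trans_le hW
    obtain ⟨o, ho⟩ := exists_order_of_isAdmissible hadm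
    have hV : (0 : ℝ) < Fintype.card V := by exact_mod_cast Fintype.card_pos
    -- Deleting all edges, at most `p * n` of them, yields an `H`-free graph, so farness bounds `ε`.
    have hεp : ε ≤ p := by
      have hbot : H.Free (⊥ : SimpleGraph V) := by
        intro hcont
        obtain ⟨ψ, hψ⟩ := exists_isCopy hcont
        obtain ⟨x, y, hxy⟩ := exists_adj_of_nontrivial hH
        exact hψ.2 x y hxy
      have h1 := ncard_edges_diff_le_of_isFar hfar bot_le hbot
      rw [SimpleGraph.edgeSet_bot, Set.sdiff_empty] at h1
      have h2 : (G.edgeSet.ncard : ℝ) ≤ Fintype.card V * p := by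
        exact_mod_cast ncard_edgeSet_le hr1 ho
      exact le_of_mul_le_mul_right (by linarith) hV
    obtain ⟨G', hle, hre, hlight, hcost⟩ :=
      exists_reroutable (H := H) (G := G) hH ho hW (by omega) hr1 hα hδ
    have hcost' : ((G.edgeSet \ G'.edgeSet).ncard : ℝ) ≤ ε / 2 * Fintype.card V := by
      refine hcost.trans ?_
      -- The budget `ε / 2` is split: a quarter for edges with heavy later end, three quarters for
      -- the pruning.
      have hα' : 2 * (p : ℝ) ^ 2 / alpha p ε = 1 / 4 * (ε / 2) := by
        have : (0 : ℝ) < p := by exact_mod_cast (by omega : 0 < p)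
        unfold alpha
        field_simp
        norm_num
      have := type_cost_le hp hr hε hεp hW
      gcongr
      linarith
    obtain ⟨A, hA, hAcard⟩ := exists_many_on_copies (H := H) hH hle hfar hα hlight hcost'
    refine ⟨G', A, ε / 2 / alpha p ε, hre, hle, fun x y h => ?_, hA, hAcard, ?_⟩
    · exact (hlight x y h).imp (fun h => h.trans (alpha_le_delta hp hr hε hεp))
        fun h => h.trans (alpha_le_delta hp hr hε hεp)
    · refine (ofReal_one_sub_pow_le (t := 20) ?_).trans (ENNReal.ofReal_le_ofReal
        ((exp_neg_le (by norm_num)).trans (by norm_num)))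
      calc (20 : ℝ) = ε / 2 / alpha p ε * (20 * alpha p ε / (ε / 2)) := by field_simp
        _ ≤ _ := by gcongr

end Far

end HFreeness

theorem theorem3 (p r : ℕ) (hp : 2 ≤ p) (ε : ℝ) (hε : 0 < ε) :
    ∃ q : ℕ, ∀ (W : Type*) [Fintype W] (H : SimpleGraph W),
      H.Connected → Fintype.card W ≤ r → ∀ (n : ℕ) [NeZero n],
        (HFreeness.tester H p r ε n).queryComplexity ≤ q ∧
        ∀ G : SimpleGraph (Fin n),
          (H.Free G →
            (HFreeness.tester H p r ε n).run G HFreeness.Verdict.accept = 1) ∧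
          (HFreeness.IsAdmissible p r G → HFreeness.IsFar ε H.Free G →
            2 / 3 ≤ (HFreeness.tester H p r ε n).run G HFreeness.Verdict.reject) := by
  refine ⟨HFreeness.queryBound (HFreeness.xi₁ p ε) (HFreeness.xi₂ r) (HFreeness.xi₃ p r ε),
    fun W _ H hH hW n _ => ⟨HFreeness.queryComplexity_tester_le H _ _ _, fun G => ⟨fun hfree =>
      HFreeness.tester_accept hfree _ _ _, fun hadm hfar => HFreeness.tester_reject
        (HFreeness.failProb_explore_le_of_isFar hH hp hW hε hadm hfar)⟩⟩⟩
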